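/- Let $N\ge 1$ be an integer, let $L=\{f\}$ be the first-order language consisting of one unary function symbol, and let $\mathcal T_N$ be the $L$-theory stating that $f$ is injective, that exactly $N$ elements are not in the image of $f$, and that $f^n(x)\neq x$ for every $x$ and every integer $n\geq 1$, where $f^n$ is the $n$-th iterate of $f$. For a structure $M$ with at least two elements, let $\widetilde{\mathrm{Def}}(M)$ be the set of all definable (with parameters in $M$) subsets of the finite Cartesian powers $M^n$, $n\ge 0$, modulo definable bijection (a bijection whose graph is definable with parameters). It is a commutative semiring, where $[A]+[B]$ is the class of a disjoint union of definable copies of $A$ and $B$ in a common Cartesian power of $M$, and $[A]\cdot[B]=[A\times B]$. The Grothendieck ring $K_0(M)$ is the ring of formal differences of elements of this semiring, in which $a$ and $b$ become equal if and only if $a+c=b+c$ for some $c\in\widetilde{\mathrm{Def}}(M)$. Then for every model $M$ of $\mathcal T_N$ there is a ring isomorphism $K_0(M)\cong(\mathbb Z/N\mathbb Z)[X]$ that maps the class $[M]$ to $X$. -/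

import Mathlib

open FirstOrder FirstOrder.Language

noncomputable section

/-! ## The ring completion of a commutative semiring -/

/-- The ring completion of a commutative semiring `R`, that is, the ring of formal differences of
elements of `R`. Its additive group is the Grothendieck group of `(R, +)`: two elements `a`, `b` of
`R` become equal in it iff `a + c = b + c` for some `c`, and every element is of the form `a - b`.
It is thus the minimal ring that contains the largest additively cancellative quotient of `R`. -/
def RingCompletion (R : Type*) [CommSemiring R] : Type _ := Algebra.GrothendieckAddGroup R

namespace RingCompletion

variable {R : Type*} [CommSemiring R]

instance : AddCommGroup (RingCompletion R) :=
  inferInstanceAs (AddCommGroup (Algebra.GrothendieckAddGroup R))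

/-- The canonical additive map `R → RingCompletion R`. -/
def ofAdd : R →+ RingCompletion R := Algebra.GrothendieckAddGroup.of

/-- The universal property of the Grothendieck group. -/
def liftAdd {G : Type*} [AddCommGroup G] (f : R →+ G) : RingCompletion R →+ G :=
  Algebra.GrothendieckAddGroup.lift f

theorem liftAdd_ofAdd {G : Type*} [AddCommGroup G] (f : R →+ G) (a : R) :
    liftAdd f (ofAdd a) = f a :=
  DFunLike.congr_fun (Algebra.GrothendieckAddGroup.lift.symm_apply_apply f) a

theorem exists_eq_sub (x : RingCompletion R) : ∃ a b : R, x = ofAdd a - ofAdd b := by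
  have key : ∀ x : Algebra.GrothendieckAddGroup R, ∃ a b : R,
      x = AddLocalization.mk a 0 - AddLocalization.mk b 0 := by
    intro x
    induction x using AddLocalization.ind with
    | _ y =>
      refine ⟨y.1, y.2, ?_⟩
      rw [Algebra.GrothendieckAddGroup.mk_sub_mk]
      congr 1
      · simp
      · ext; simp
  exact key x

theorem ofAdd_eq_iff {a b : R} : ofAdd a = ofAdd b ↔ ∃ c, a + c = b + c := by
  change AddLocalization.mk a 0 = AddLocalization.mk b 0 ↔ _
  rw [AddLocalization.mk_eq_mk_iff, AddLocalization.r_iff_exists]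
  constructor
  · rintro ⟨c, hc⟩
    exact ⟨c, by simpa [add_comm] using hc⟩
  · rintro ⟨c, hc⟩
    exact ⟨⟨c, trivial⟩, by simpa [add_comm] using hc⟩

theorem ind {p : RingCompletion R → Prop} (h : ∀ a, p (ofAdd a))
    (hs : ∀ x y, p x → p y → p (x - y)) (x : RingCompletion R) : p x := by
  obtain ⟨a, b, rfl⟩ := exists_eq_sub x
  exact hs _ _ (h a) (h b)

/-- Multiplication as a biadditive map, extending the multiplication of `R`. -/
def mulHom : RingCompletion R →+ RingCompletion R →+ RingCompletion R :=
  liftAdd (AddMonoidHom.mk' (fun a : R => liftAdd (ofAdd.comp (AddMonoidHom.mulLeft a)))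
    (fun a b => by
      ext x
      induction x using ind with
      | h c => simp [liftAdd_ofAdd, add_mul]
      | hs x y hx hy => rw [map_sub, hx, hy, map_sub]))

instance : Mul (RingCompletion R) := ⟨fun x y => mulHom x y⟩

theorem ofAdd_mul_ofAdd (a b : R) : ofAdd a * ofAdd b = ofAdd (a * b) := by
  change mulHom (ofAdd a) (ofAdd b) = _
  simp [mulHom, liftAdd_ofAdd]

theorem sub_mul' (x y z : RingCompletion R) : (x - y) * z = x * z - y * z := by
  change mulHom (x - y) z = _
  rw [map_sub]; rfl

theorem mul_sub' (x y z : RingCompletion R) : z * (x - y) = z * x - z * y := by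
  change mulHom z (x - y) = _
  rw [map_sub]; rfl

theorem mul_comm' (x y : RingCompletion R) : x * y = y * x := by
  induction x using ind with
  | h a =>
    induction y using ind with
    | h b => rw [ofAdd_mul_ofAdd, ofAdd_mul_ofAdd, mul_comm]
    | hs y z hy hz => rw [sub_mul', mul_sub', hy, hz]
  | hs x z hx hz => rw [sub_mul', mul_sub', hx, hz]

theorem mul_assoc' (x y z : RingCompletion R) : x * y * z = x * (y * z) := by
  induction x using ind with
  | h a =>
    induction y using ind with
    | h b =>
      induction z using ind with
      | h c => simp only [ofAdd_mul_ofAdd, mul_assoc]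
      | hs z w hz hw => rw [mul_sub', hz, hw, mul_sub', mul_sub']
    | hs y w hy hw => rw [mul_sub', sub_mul', sub_mul', hy, hw, mul_sub']
  | hs x w hx hw => rw [sub_mul', sub_mul', hx, hw, sub_mul']

theorem one_mul' (x : RingCompletion R) : ofAdd 1 * x = x := by
  induction x using ind with
  | h a => rw [ofAdd_mul_ofAdd, one_mul]
  | hs x y hx hy => rw [mul_sub', hx, hy]

instance : CommRing (RingCompletion R) where
  one := ofAdd 1
  mul_assoc := mul_assoc'
  mul_comm := mul_comm'
  one_mul := one_mul'
  mul_one x := (mul_comm' _ _).trans (one_mul' x)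
  zero_mul x := by change mulHom 0 x = 0; simp
  mul_zero x := by change mulHom x 0 = 0; simp
  left_distrib x y z := by change mulHom x (y + z) = _; rw [map_add]; rfl
  right_distrib x y z := by change mulHom (x + y) z = _; rw [map_add]; rfl
  zsmul := fun n x => n • x
  zsmul_zero' := zero_zsmul
  zsmul_succ' := SubNegMonoid.zsmul_succ'
  zsmul_neg' := SubNegMonoid.zsmul_neg'
  nsmul := fun n x => n • x
  nsmul_zero := zero_nsmul
  nsmul_succ := AddMonoid.nsmul_succ
  sub_eq_add_neg := sub_eq_add_neg
  neg_add_cancel := neg_add_cancel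

/-- The canonical homomorphism from a commutative semiring to its ring completion. -/
def of : R →+* RingCompletion R where
  toFun := ofAdd
  map_zero' := map_zero ofAdd
  map_add' := map_add ofAdd
  map_one' := rfl
  map_mul' a b := (ofAdd_mul_ofAdd a b).symm

end RingCompletion

/-! ## The Grothendieck semiring and the Grothendieck ring of a structure -/

namespace DefinableSets

open Set

section Basic

variable (L : FirstOrder.Language) {M : Type*} [L.Structure M]

/-- A subset of `M ^ α` is definable if it is first-order definable with parameters in `M`. -/
abbrev IsDef {α : Type} (S : Set (α → M)) : Prop := (univ : Set M).Definable L S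

/-- There is a definable bijection between `S ⊆ M ^ α` and `T ⊆ M ^ β`, that is, a bijection whose
graph is a definable subset of `M ^ (α ⊕ β)`. -/
def DefBij {α β : Type} (S : Set (α → M)) (T : Set (β → M)) : Prop :=
  ∃ e : S ≃ T, IsDef L {w : α ⊕ β → M | ∃ x : S, w ∘ Sum.inl = x ∧ w ∘ Sum.inr = e x}

variable {L} {α β γ δ : Type}

theorem defBij_iff {S : Set (α → M)} {T : Set (β → M)} :
    DefBij L S T ↔ ∃ R : Set (α ⊕ β → M), IsDef L R ∧
      (∀ x y, Sum.elim x y ∈ R → x ∈ S ∧ y ∈ T) ∧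
      (∀ x ∈ S, ∃! y, Sum.elim x y ∈ R) ∧ (∀ y ∈ T, ∃! x, Sum.elim x y ∈ R) := by
  constructor
  · rintro ⟨e, he⟩
    refine ⟨_, he, ?_, ?_, ?_⟩
    · rintro x y ⟨u, hx, hy⟩
      simp only [Sum.elim_comp_inl, Sum.elim_comp_inr] at hx hy
      subst hx hy
      exact ⟨u.2, (e u).2⟩
    · intro x hx
      refine ⟨e ⟨x, hx⟩, ⟨⟨x, hx⟩, by simp⟩, ?_⟩
      rintro y ⟨u, hu, hy⟩
      simp only [Sum.elim_comp_inl, Sum.elim_comp_inr] at hu hy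
      subst hu hy
      rfl
    · intro y hy
      refine ⟨e.symm ⟨y, hy⟩, ⟨e.symm ⟨y, hy⟩, by simp⟩, ?_⟩
      rintro x ⟨u, hu, hy⟩
      simp only [Sum.elim_comp_inl, Sum.elim_comp_inr] at hu hy
      subst hu hy
      simp
  · rintro ⟨R, hR, h, h1, h2⟩
    choose f hf hf' using h1
    choose g hg hg' using h2
    refine ⟨⟨fun x => ⟨f x x.2, (h _ _ (hf x x.2)).2⟩, fun y => ⟨g y y.2, (h _ _ (hg y y.2)).1⟩,
      ?_, ?_⟩, ?_⟩
    · rintro ⟨x, hx⟩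
      exact Subtype.ext (hg' _ (h _ _ (hf x hx)).2 x (hf x hx)).symm
    · rintro ⟨y, hy⟩
      exact Subtype.ext (hf' _ (h _ _ (hg y hy)).1 y (hg y hy)).symm
    · convert hR using 1
      ext w
      have hw : w = Sum.elim (w ∘ Sum.inl) (w ∘ Sum.inr) := (Sum.elim_comp_inl_inr w).symm
      constructor
      · rintro ⟨⟨x, hx⟩, h1, h2⟩
        rw [hw, h1, h2]
        exact hf x hx
      · intro hw'
        rw [hw] at hw'
        refine ⟨⟨_, (h _ _ hw').1⟩, rfl, ?_⟩
        exact hf' _ (h _ _ hw').1 _ hw'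

theorem DefBij.symm {S : Set (α → M)} {T : Set (β → M)} (h : DefBij L S T) : DefBij L T S := by
  obtain ⟨R, hR, h, h1, h2⟩ := defBij_iff.1 h
  refine defBij_iff.2 ⟨_, hR.preimage_comp Sum.swap, ?_, ?_, ?_⟩
  · intro x y hxy
    refine (h y x ?_).symm
    simpa using hxy
  · simpa using h2
  · simpa using h1

theorem DefBij.trans [Finite β] {S : Set (α → M)} {T : Set (β → M)}
    {U : Set (γ → M)} (h : DefBij L S T) (h' : DefBij L T U) : DefBij L S U := by
  obtain ⟨R, hR, h, h1, h2⟩ := defBij_iff.1 h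
  obtain ⟨R', hR', h', h1', h2'⟩ := defBij_iff.1 h'
  refine defBij_iff.2 ⟨{w | ∃ u : β → M, Sum.elim w u ∈
    {v : (α ⊕ γ) ⊕ β → M | Sum.elim (v ∘ Sum.inl ∘ Sum.inl) (v ∘ Sum.inr) ∈ R ∧
      Sum.elim (v ∘ Sum.inr) (v ∘ Sum.inl ∘ Sum.inr) ∈ R'}}, ?_, ?_, ?_, ?_⟩
  · refine Definable.exists_of_finite (Definable.inter ?_ ?_)
    · have := hR.preimage_comp (Sum.elim (Sum.inl ∘ Sum.inl) Sum.inr : α ⊕ β → (α ⊕ γ) ⊕ β)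
      simp only [preimage, Sum.comp_elim] at this
      exact this
    · have := hR'.preimage_comp (Sum.elim Sum.inr (Sum.inl ∘ Sum.inr) : β ⊕ γ → (α ⊕ γ) ⊕ β)
      simp only [preimage, Sum.comp_elim] at this
      exact this
  · rintro x z ⟨y, hxy, hyz⟩
    exact ⟨(h _ _ hxy).1, (h' _ _ hyz).2⟩
  · intro x hx
    obtain ⟨y, hy, hy'⟩ := h1 x hx
    obtain ⟨z, hz, hz'⟩ := h1' y (h _ _ hy).2
    refine ⟨z, ⟨y, hy, hz⟩, ?_⟩
    rintro z' ⟨y', hxy, hyz⟩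
    obtain rfl := hy' y' hxy
    exact hz' z' hyz
  · intro z hz
    obtain ⟨y, hy, hy'⟩ := h2' z hz
    obtain ⟨x, hx, hx'⟩ := h2 y (h' _ _ hy).1
    refine ⟨x, ⟨y, hx, hy⟩, ?_⟩
    rintro x' ⟨y', hxy, hyz⟩
    obtain rfl := hy' y' hyz
    exact hx' x' hxy

/-- Two sets are in definable bijection if there are definable total maps that restrict to mutually
inverse bijections between them. -/
theorem DefBij.of_maps [Finite β] {S : Set (α → M)} {T : Set (β → M)} (hS : IsDef L S)
    (F : (α → M) → β → M) (G : (β → M) → α → M) (hF : (univ : Set M).DefinableMap L F)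
    (h1 : ∀ x ∈ S, F x ∈ T ∧ G (F x) = x) (h2 : ∀ y ∈ T, G y ∈ S ∧ F (G y) = y) :
    DefBij L S T := by
  refine ⟨⟨fun x => ⟨F x, (h1 x x.2).1⟩, fun y => ⟨G y, (h2 y y.2).1⟩,
    fun x => Subtype.ext (h1 x x.2).2, fun y => Subtype.ext (h2 y y.2).2⟩, ?_⟩
  have hG : IsDef L {w : α ⊕ β → M | ∀ i, F (w ∘ Sum.inl) i = w (Sum.inr i)} := by
    rw [ofPred_forall]
    refine definable_iInter_of_finite fun i => ?_
    simpa [Function.tupleGraph] using!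
      (hF i).preimage_comp (fun | none => Sum.inr i | some j => Sum.inl j)
  convert (hS.preimage_comp Sum.inl).inter hG using 1
  ext w
  constructor
  · rintro ⟨⟨x, hx⟩, rfl, h⟩
    exact ⟨hx, fun i => (congrFun h i).symm⟩
  · rintro ⟨hx, h⟩
    exact ⟨⟨_, hx⟩, rfl, (funext h).symm⟩

theorem DefBij.refl [Finite α] {S : Set (α → M)} (hS : IsDef L S) : DefBij L S S :=
  .of_maps hS id id (fun _ => DefinableFun.proj L) (fun _ h => ⟨h, rfl⟩) (fun _ h => ⟨h, rfl⟩)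

theorem DefBij.reindex [Finite β] {S : Set (α → M)} (hS : IsDef L S)
    (f : α ≃ β) : DefBij L S {v : β → M | v ∘ f ∈ S} :=
  .of_maps hS (fun x => x ∘ f.symm) (fun y => y ∘ f) (fun _ => DefinableFun.proj L)
    (fun x h => by simpa [Function.comp_assoc] using h) (fun y h => ⟨h, by ext; simp⟩)

theorem DefBij.union {S S' : Set (α → M)} {T T' : Set (β → M)} (h : DefBij L S T)
    (h' : DefBij L S' T') (hS : Disjoint S S') (hT : Disjoint T T') :
    DefBij L (S ∪ S') (T ∪ T') := by
  obtain ⟨R, hR, h, h1, h2⟩ := defBij_iff.1 h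
  obtain ⟨R', hR', h', h1', h2'⟩ := defBij_iff.1 h'
  rw [Set.disjoint_left] at hS hT
  refine defBij_iff.2 ⟨_, hR.union hR', ?_, ?_, ?_⟩
  · rintro x y (hxy | hxy)
    · exact ⟨.inl (h _ _ hxy).1, .inl (h _ _ hxy).2⟩
    · exact ⟨.inr (h' _ _ hxy).1, .inr (h' _ _ hxy).2⟩
  · rintro x (hx | hx)
    · obtain ⟨y, hy, hy'⟩ := h1 x hx
      refine ⟨y, .inl hy, ?_⟩
      rintro y' (hy'' | hy'')
      · exact hy' _ hy''
      · exact (hS hx (h' _ _ hy'').1).elim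
    · obtain ⟨y, hy, hy'⟩ := h1' x hx
      refine ⟨y, .inr hy, ?_⟩
      rintro y' (hy'' | hy'')
      · exact (hS (h _ _ hy'').1 hx).elim
      · exact hy' _ hy''
  · rintro y (hy | hy)
    · obtain ⟨x, hx, hx'⟩ := h2 y hy
      refine ⟨x, .inl hx, ?_⟩
      rintro x' (hx'' | hx'')
      · exact hx' _ hx''
      · exact (hT hy (h' _ _ hx'').2).elim
    · obtain ⟨x, hx, hx'⟩ := h2' y hy
      refine ⟨x, .inr hx, ?_⟩
      rintro x' (hx'' | hx'')
      · exact (hT (h _ _ hx'').2 hy).elim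
      · exact hx' _ hx''

/-- The Cartesian product `S × T`, as a subset of `M ^ (α ⊕ β)`. -/
def prodSet (S : Set (α → M)) (T : Set (β → M)) : Set (α ⊕ β → M) :=
  {w | w ∘ Sum.inl ∈ S ∧ w ∘ Sum.inr ∈ T}

theorem prodSet_def {S : Set (α → M)} {T : Set (β → M)} (hS : IsDef L S) (hT : IsDef L T) :
    IsDef L (prodSet S T) :=
  (hS.preimage_comp Sum.inl).inter (hT.preimage_comp Sum.inr)

theorem DefBij.prod {S : Set (α → M)} {S' : Set (β → M)} {T : Set (γ → M)} {T' : Set (δ → M)}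
    (h : DefBij L S S') (h' : DefBij L T T') : DefBij L (prodSet S T) (prodSet S' T') := by
  obtain ⟨R, hR, h, h1, h2⟩ := defBij_iff.1 h
  obtain ⟨R', hR', h', h1', h2'⟩ := defBij_iff.1 h'
  refine defBij_iff.2 ⟨_, (hR.preimage_comp (Sum.map Sum.inl Sum.inl)).inter
    (hR'.preimage_comp (Sum.map Sum.inr Sum.inr)), ?_, ?_, ?_⟩
  · rintro x y ⟨hxy, hxy'⟩
    simp only [mem_preimage, Sum.elim_comp_map] at hxy hxy'
    exact ⟨⟨(h _ _ hxy).1, (h' _ _ hxy').1⟩, (h _ _ hxy).2, (h' _ _ hxy').2⟩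
  · rintro x ⟨hx, hx'⟩
    obtain ⟨y, hy, hyu⟩ := h1 _ hx
    obtain ⟨y', hy', hyu'⟩ := h1' _ hx'
    refine ⟨Sum.elim y y', ⟨by simpa [Sum.elim_comp_map] using hy,
      by simpa [Sum.elim_comp_map] using hy'⟩, ?_⟩
    rintro z ⟨hz, hz'⟩
    simp only [mem_preimage, Sum.elim_comp_map] at hz hz'
    rw [← hyu _ hz, ← hyu' _ hz', Sum.elim_comp_inl_inr]
  · rintro x ⟨hx, hx'⟩
    obtain ⟨y, hy, hyu⟩ := h2 _ hx
    obtain ⟨y', hy', hyu'⟩ := h2' _ hx'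
    refine ⟨Sum.elim y y', ⟨by simpa [Sum.elim_comp_map] using hy,
      by simpa [Sum.elim_comp_map] using hy'⟩, ?_⟩
    rintro z ⟨hz, hz'⟩
    simp only [mem_preimage, Sum.elim_comp_map] at hz hz'
    rw [← hyu _ hz, ← hyu' _ hz', Sum.elim_comp_inl_inr]

/-- The copy `S × {(p, …, p)}` of `S ⊆ M ^ α` in `M ^ (α ⊕ β)`. -/
def pad (β : Type) (S : Set (α → M)) (p : M) : Set (α ⊕ β → M) :=
  {w | w ∘ Sum.inl ∈ S ∧ ∀ j, w (Sum.inr j) = p}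

theorem const_def [Finite β] (f : β → α) (p : M) : IsDef L {w : α → M | ∀ j, w (f j) = p} := by
  rw [ofPred_forall]
  exact definable_iInter_of_finite fun i =>
    DefinableFun.ofPred_eq_const (DefinableFun.proj L) (mem_univ p)

theorem pad_def [Finite β] {S : Set (α → M)} (hS : IsDef L S) (p : M) : IsDef L (pad β S p) :=
  (hS.preimage_comp Sum.inl).inter (const_def _ p)

theorem defBij_pad [Finite α] [Finite β] {S : Set (α → M)} (hS : IsDef L S) (p : M) :
    DefBij L S (pad β S p) := by
  refine .of_maps hS (fun x => Sum.elim x fun _ => p) (fun w => w ∘ Sum.inl) ?_ ?_ ?_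
  · rintro (i | i)
    · exact DefinableFun.proj L
    · exact L.definableFun_const _ (mem_univ p)
  · intro x hx
    exact ⟨⟨by simpa using hx, by simp⟩, by simp⟩
  · rintro y ⟨hy, hy'⟩
    refine ⟨hy, ?_⟩
    ext (i | i) <;> simp [hy']

/-- The disjoint union of `S ⊆ M ^ α` and `T ⊆ M ^ β`, formed in `M ^ ((α ⊕ β) ⊕ Unit)` by means of
two elements `p ≠ q` of `M`: it is
`S × {(p, …, p)} × {p} ∪ {(q, …, q)} × T × {q}`. -/
def sumSet (p q : M) (S : Set (α → M)) (T : Set (β → M)) : Set ((α ⊕ β) ⊕ Unit → M) :=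
  pad Unit (pad β S p) p ∪ pad Unit {w | w ∘ Sum.swap ∈ pad α T q} q

theorem disjoint_pad {p q : M} (hpq : p ≠ q) (S T : Set (α → M)) :
    Disjoint (pad Unit S p) (pad Unit T q) := by
  rw [Set.disjoint_left]
  rintro w ⟨-, h⟩ ⟨-, h'⟩
  exact hpq ((h ()).symm.trans (h' ()))

theorem defBij_pad' [Finite α] [Finite β] {S : Set (α → M)} (hS : IsDef L S) (p : M) :
    DefBij L S (pad Unit {w : β ⊕ α → M | w ∘ Sum.swap ∈ pad β S p} p) :=
  ((defBij_pad hS p).trans (.reindex (pad_def hS p) (Equiv.sumComm α β))).trans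
    (defBij_pad ((pad_def hS p).preimage_comp Sum.swap) p)

theorem defBij_pad_pad [Finite α] [Finite β] {S : Set (α → M)} (hS : IsDef L S) (p : M) :
    DefBij L S (pad Unit (pad β S p) p) :=
  (defBij_pad hS p).trans (defBij_pad (pad_def hS p) p)

theorem sumSet_def [Finite α] [Finite β] {S : Set (α → M)} {T : Set (β → M)} (hS : IsDef L S)
    (hT : IsDef L T) (p q : M) : IsDef L (sumSet p q S T) :=
  (pad_def (pad_def hS p) p).union (pad_def ((pad_def hT q).preimage_comp Sum.swap) q)

/-- A disjoint union of copies of `S` and `T` is in definable bijection with `sumSet p q S T`. -/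
theorem defBij_sumSet [Finite α] [Finite β] [Finite γ] {S : Set (α → M)} {T : Set (β → M)}
    {S' T' : Set (γ → M)} (hS : IsDef L S) (hT : IsDef L T) {p q : M} (hpq : p ≠ q)
    (h : DefBij L S' S) (h' : DefBij L T' T) (hd : Disjoint S' T') :
    DefBij L (S' ∪ T') (sumSet p q S T) :=
  (h.trans (defBij_pad_pad hS p)).union (h'.trans (defBij_pad' hT q)) hd (disjoint_pad hpq _ _)

end Basic

end DefinableSets

/-- A definable set: a definable (with parameters) subset of some Cartesian power `M ^ n`. -/
structure DefSet (L : FirstOrder.Language) (M : Type*) [L.Structure M] where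
  /-- the exponent of the Cartesian power -/
  dim : ℕ
  /-- the underlying set -/
  carrier : Set (Fin dim → M)
  /-- definability with parameters -/
  isDef : DefinableSets.IsDef L carrier

/-- Definable sets up to definable bijection. -/
instance DefSet.setoid (L : FirstOrder.Language) (M : Type*) [L.Structure M] : Setoid (DefSet L M) where
  r A B := DefinableSets.DefBij L A.carrier B.carrier
  iseqv := ⟨fun A => .refl A.isDef, fun h => h.symm, fun h h' => h.trans h'⟩

/-- The set of classes of definable sets up to definable bijection, which carries the Grothendieck
semiring of `M`. -/
def GrothendieckSemiring (L : FirstOrder.Language) (M : Type*) [L.Structure M] : Type _ :=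
  Quotient (DefSet.setoid L M)

namespace GrothendieckSemiring

open DefinableSets Set

variable {L : FirstOrder.Language} {M : Type*} [L.Structure M] {α β γ : Type} [Finite α] [Finite β] [Finite γ]

/-- The class `[S]` of a definable set `S ⊆ M ^ α`, where `α` is any finite type; the set is
transported to `M ^ n` along an enumeration of `α`, on whose choice the class does not depend. -/
def cls (S : Set (α → M)) (hS : IsDef L S) : GrothendieckSemiring L M :=
  Quotient.mk _ ⟨Nat.card α, {v | v ∘ Finite.equivFin α ∈ S}, hS.preimage_comp (Finite.equivFin α)⟩

theorem cls_eq_cls {S : Set (α → M)} {hS : IsDef L S} {T : Set (β → M)} {hT : IsDef L T} :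
    cls S hS = cls T hT ↔ DefBij L S T := by
  refine Quotient.eq.trans ⟨fun h => ?_, fun h => ?_⟩
  · exact (DefBij.reindex hS _).trans (DefBij.trans h (DefBij.reindex hT _).symm)
  · exact (DefBij.reindex hS _).symm.trans (h.trans (DefBij.reindex hT _))

theorem cls_fin (A : DefSet L M) : cls A.carrier A.isDef = Quotient.mk _ A :=
  Quotient.sound (DefBij.reindex A.isDef (Finite.equivFin _)).symm

theorem ind {P : GrothendieckSemiring L M → Prop}
    (h : ∀ (n : ℕ) (S : Set (Fin n → M)) (hS : IsDef L S), P (cls S hS))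
    (a : GrothendieckSemiring L M) : P a := by
  induction a using Quotient.ind with
  | _ A => rw [← cls_fin A]; exact h _ _ _

instance : Zero (GrothendieckSemiring L M) := ⟨cls (∅ : Set (Fin 0 → M)) definable_empty⟩

instance : One (GrothendieckSemiring L M) := ⟨cls (univ : Set (Fin 0 → M)) definable_univ⟩

/-- The product `[A] * [B]` is the class of the Cartesian product `A × B`. -/
instance : Mul (GrothendieckSemiring L M) where
  mul := Quotient.lift₂
    (fun A B => cls (prodSet A.carrier B.carrier) (prodSet_def A.isDef B.isDef))
    (fun _ _ _ _ h h' => cls_eq_cls.2 (DefBij.prod h h'))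

theorem cls_mul_cls {S : Set (α → M)} {T : Set (β → M)} (hS : IsDef L S) (hT : IsDef L T) :
    cls S hS * cls T hT = cls (prodSet S T) (prodSet_def hS hT) :=
  cls_eq_cls (hS := prodSet_def (hS.preimage_comp _) (hT.preimage_comp _)).2
    (DefBij.prod (DefBij.reindex hS _).symm (DefBij.reindex hT _).symm)

theorem cls_congr {S T : Set (α → M)} (h : S = T) (hS : IsDef L S) (hT : IsDef L T) :
    cls S hS = cls T hT := by
  subst h; rfl

protected theorem mul_comm (a b : GrothendieckSemiring L M) : a * b = b * a := by
  induction a using ind with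
  | _ n S hS =>
    induction b using ind with
    | _ m T hT =>
      rw [cls_mul_cls, cls_mul_cls]
      refine cls_eq_cls.2 ?_
      convert DefBij.reindex (prodSet_def hS hT) (Equiv.sumComm _ _) using 1
      ext w
      exact and_comm

protected theorem mul_assoc (a b c : GrothendieckSemiring L M) : a * b * c = a * (b * c) := by
  induction a using ind with
  | _ n S hS =>
    induction b using ind with
    | _ m T hT =>
      induction c using ind with
      | _ k U hU =>
        simp only [cls_mul_cls]
        refine cls_eq_cls.2 ?_
        convert DefBij.reindex (prodSet_def (prodSet_def hS hT) hU) (Equiv.sumAssoc _ _ _) using 1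
        ext w
        exact and_assoc.symm

protected theorem one_mul (a : GrothendieckSemiring L M) : 1 * a = a := by
  induction a using ind with
  | _ n S hS =>
    refine (cls_mul_cls definable_univ hS).trans (cls_eq_cls.2 ?_)
    refine DefBij.symm ?_
    convert DefBij.reindex hS (Equiv.emptySum (Fin 0) (Fin n)).symm using 1
    ext w
    simp [prodSet, Function.comp_def]

protected theorem zero_mul (a : GrothendieckSemiring L M) : 0 * a = 0 := by
  induction a using ind with
  | _ n S hS =>
    refine (cls_mul_cls definable_empty hS).trans (cls_eq_cls.2 ?_)
    exact ⟨⟨fun x => x.2.1.elim, fun x => x.2.elim, fun x => x.2.1.elim, fun x => x.2.elim⟩, by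
        convert definable_empty
        ext w
        simp [prodSet]⟩

section Nontrivial

variable [Nontrivial M]

variable (M) in
/-- An element of `M`, used to form disjoint unions. -/
def pt₁ : M := (exists_pair_ne M).choose

variable (M) in
/-- An element of `M` other than `pt₁ M`, used to form disjoint unions. -/
def pt₂ : M := (exists_pair_ne M).choose_spec.choose

theorem pt_ne : pt₁ M ≠ pt₂ M := (exists_pair_ne M).choose_spec.choose_spec

theorem defBij_sumSet_pt {S : Set (α → M)} {T : Set (β → M)} {S' T' : Set (γ → M)}
    (hS : IsDef L S) (hT : IsDef L T) (h : DefBij L S' S) (h' : DefBij L T' T)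
    (hd : Disjoint S' T') : DefBij L (S' ∪ T') (sumSet (pt₁ M) (pt₂ M) S T) :=
  defBij_sumSet hS hT pt_ne h h' hd

theorem sumSet_congr {α' β' : Type} [Finite α'] [Finite β'] {S : Set (α → M)} {T : Set (β → M)}
    {S' : Set (α' → M)} {T' : Set (β' → M)} (hS : IsDef L S) (hT : IsDef L T) (hS' : IsDef L S')
    (hT' : IsDef L T') (h : DefBij L S S') (h' : DefBij L T T') :
    DefBij L (sumSet (pt₁ M) (pt₂ M) S T) (sumSet (pt₁ M) (pt₂ M) S' T') :=
  defBij_sumSet_pt hS' hT' ((defBij_pad_pad hS _).symm.trans h) ((defBij_pad' hT _).symm.trans h')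
    (disjoint_pad pt_ne _ _)

/-- The sum `[A] + [B]` is the class of the disjoint union of `A` and `B`. -/
instance : Add (GrothendieckSemiring L M) where
  add := Quotient.lift₂
    (fun A B => cls (sumSet (pt₁ M) (pt₂ M) A.carrier B.carrier) (sumSet_def A.isDef B.isDef _ _))
    (fun A B A' B' h h' => cls_eq_cls.2 (sumSet_congr A.isDef B.isDef A'.isDef B'.isDef h h'))

theorem cls_add_cls {S : Set (α → M)} {T : Set (β → M)} (hS : IsDef L S) (hT : IsDef L T) :
    cls S hS + cls T hT = cls (sumSet (pt₁ M) (pt₂ M) S T) (sumSet_def hS hT _ _) :=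
  cls_eq_cls (hS := sumSet_def (hS.preimage_comp _) (hT.preimage_comp _) _ _).2
    (sumSet_congr (hS.preimage_comp _) (hT.preimage_comp _) hS hT (DefBij.reindex hS _).symm
      (DefBij.reindex hT _).symm)

/-- Additivity on disjoint definable subsets of the same Cartesian power. -/
theorem cls_union {S T : Set (α → M)} (hS : IsDef L S) (hT : IsDef L T) (hd : Disjoint S T) :
    cls (S ∪ T) (hS.union hT) = cls S hS + cls T hT := by
  rw [cls_add_cls]
  exact cls_eq_cls.2 (defBij_sumSet_pt hS hT (.refl hS) (.refl hT) hd)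

/-- Any two classes are the classes of disjoint definable subsets of one Cartesian power. -/
theorem ind_disjoint {P : GrothendieckSemiring L M → GrothendieckSemiring L M → Prop}
    (h : ∀ (α : Type) [Finite α] (S T : Set (α → M)) (hS : IsDef L S) (hT : IsDef L T),
      Disjoint S T → P (cls S hS) (cls T hT)) (a b : GrothendieckSemiring L M) : P a b := by
  induction a using ind with
  | _ n S hS =>
    induction b using ind with
    | _ m T hT =>
      have h1 := cls_eq_cls (hS := hS) (hT := pad_def (pad_def hS (pt₁ M)) (pt₁ M)).2
        (defBij_pad_pad (β := Fin m) hS _)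
      have h2 := cls_eq_cls (hS := hT)
        (hT := pad_def ((pad_def hT (pt₂ M)).preimage_comp Sum.swap) (pt₂ M)).2
        (defBij_pad' (β := Fin n) hT _)
      rw [h1, h2]
      exact h _ _ _ _ _ (disjoint_pad pt_ne _ _)

protected theorem add_comm (a b : GrothendieckSemiring L M) : a + b = b + a := by
  induction a, b using ind_disjoint with
  | h α S T hS hT hd =>
    rw [← cls_union hS hT hd, ← cls_union hT hS hd.symm]
    exact cls_congr (union_comm _ _) _ _

protected theorem zero_add (a : GrothendieckSemiring L M) : 0 + a = a := by
  induction a using ind with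
  | _ n S hS =>
    have h0 : (0 : GrothendieckSemiring L M) = cls (∅ : Set (Fin n → M)) definable_empty :=
      cls_eq_cls.2 ⟨⟨fun x => x.2.elim, fun x => x.2.elim, fun x => x.2.elim, fun x => x.2.elim⟩, by
        convert definable_empty
        ext w
        simp⟩
    rw [h0, ← cls_union _ hS (empty_disjoint S)]
    exact cls_congr (empty_union S) _ _

protected theorem add_assoc (a b c : GrothendieckSemiring L M) : a + b + c = a + (b + c) := by
  induction a, b using ind_disjoint with
  | h α S T hS hT hd =>
    induction c using ind with
    | _ n U hU =>
      have e1 : ∀ {A : Set (α → M)} (hA : IsDef L A), cls A hA = _ := fun {A} hA =>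
        cls_eq_cls (hT := pad_def (pad_def hA (pt₁ M)) (pt₁ M)).2
          (defBij_pad_pad (β := Fin n) hA _)
      have e2 := cls_eq_cls (hS := hU)
        (hT := pad_def ((pad_def hU (pt₂ M)).preimage_comp Sum.swap) (pt₂ M)).2
        (defBij_pad' (β := α) hU _)
      have h : ∀ A : Set (α → M), Disjoint (pad Unit (pad (Fin n) A (pt₁ M)) (pt₁ M))
        (pad Unit ((fun g => g ∘ Sum.swap) ⁻¹' pad α U (pt₂ M)) (pt₂ M)) :=
        fun A => disjoint_pad pt_ne _ _
      have hd' : Disjoint (pad Unit (pad (Fin n) S (pt₁ M)) (pt₁ M))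
          (pad Unit (pad (Fin n) T (pt₁ M)) (pt₁ M)) := by
        rw [Set.disjoint_left] at hd ⊢
        exact fun w h1 h2 => hd h1.1.1 h2.1.1
      rw [← cls_union hS hT hd, e1, e1 hS, e1 hT, e2, ← cls_union _ _ (h _),
        ← cls_union _ _ (h _), ← cls_union _ _ (disjoint_union_right.2 ⟨hd', h _⟩)]
      refine cls_congr ?_ _ _
      rw [← union_assoc]
      congr 1
      ext w
      simp only [pad, mem_ofPred_eq, mem_union]
      tauto

protected theorem left_distrib (a b c : GrothendieckSemiring L M) :
    a * (b + c) = a * b + a * c := by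
  induction b, c using ind_disjoint with
  | h α S T hS hT hd =>
    induction a using ind with
    | _ n U hU =>
      rw [← cls_union hS hT hd, cls_mul_cls, cls_mul_cls, cls_mul_cls, ← cls_union]
      · exact cls_congr (by ext w; simp only [prodSet, mem_ofPred_eq, mem_union]; tauto) _ _
      · rw [Set.disjoint_left] at hd ⊢
        exact fun w h1 h2 => hd h1.2 h2.2

instance : CommSemiring (GrothendieckSemiring L M) where
  add_assoc := GrothendieckSemiring.add_assoc
  zero_add := GrothendieckSemiring.zero_add
  add_zero a := (GrothendieckSemiring.add_comm a 0).trans (GrothendieckSemiring.zero_add a)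
  add_comm := GrothendieckSemiring.add_comm
  left_distrib := GrothendieckSemiring.left_distrib
  right_distrib a b c := by
    rw [GrothendieckSemiring.mul_comm, GrothendieckSemiring.left_distrib,
      GrothendieckSemiring.mul_comm c, GrothendieckSemiring.mul_comm c]
  zero_mul := GrothendieckSemiring.zero_mul
  mul_zero a := (GrothendieckSemiring.mul_comm a 0).trans (GrothendieckSemiring.zero_mul a)
  mul_assoc := GrothendieckSemiring.mul_assoc
  one_mul := GrothendieckSemiring.one_mul
  mul_one a := (GrothendieckSemiring.mul_comm a 1).trans (GrothendieckSemiring.one_mul a)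
  mul_comm := GrothendieckSemiring.mul_comm
  nsmul := nsmulRec

/-- The inclusion-exclusion formula `[A] + [B] = [A ∩ B] + [A ∪ B]`. -/
theorem cls_add_cls_eq_inter_add_union {S T : Set (α → M)} (hS : IsDef L S) (hT : IsDef L T) :
    cls S hS + cls T hT = cls (S ∩ T) (hS.inter hT) + cls (S ∪ T) (hS.union hT) := by
  have hd : Disjoint (S ∩ T) (T \ S) := disjoint_sdiff_right.mono_left inter_subset_left
  have h1 : cls (S ∪ T) (hS.union hT) = cls S hS + cls (T \ S) (hT.sdiff hS) := by
    rw [← cls_union _ _ disjoint_sdiff_right]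
    exact cls_congr (by simp) _ _
  have h2 : cls T hT = cls (S ∩ T) (hS.inter hT) + cls (T \ S) (hT.sdiff hS) := by
    rw [← cls_union _ _ hd]
    exact cls_congr (by rw [inter_comm, inter_union_sdiff]) _ _
  rw [h1, h2, add_left_comm]

end Nontrivial

end GrothendieckSemiring

/-- The Grothendieck ring `K₀(M)` of a structure `M` with at least two elements (in a one-point
structure there is no room for disjoint unions in the Cartesian powers). -/
abbrev K₀ (L : FirstOrder.Language) (M : Type*) [L.Structure M] [Nontrivial M] : Type _ :=
  RingCompletion (GrothendieckSemiring L M)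

/-- The class in `K₀(M)` of a definable set `S ⊆ M ^ n`. -/
def K₀.cls {L : FirstOrder.Language} {M : Type*} [L.Structure M] [Nontrivial M] {n : ℕ} (S : Set (Fin n → M))
    (hS : DefinableSets.IsDef L S) : K₀ L M :=
  RingCompletion.of (GrothendieckSemiring.cls S hS)

/-- The class `[M]` in `K₀(M)`: the class of `M ^ 1`. -/
def K₀.self (L : FirstOrder.Language) (M : Type*) [L.Structure M] [Nontrivial M] : K₀ L M :=
  K₀.cls (Set.univ : Set (Fin 1 → M)) Set.definable_univ

/-! ## The theory -/

namespace NoCycles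

/-- The only symbol of the language: a unary function symbol `f`. -/
inductive Func : ℕ → Type
  | f : Func 1

/-- The language `{f}` with one unary function symbol. -/
def lang : FirstOrder.Language.{0, 0} := ⟨Func, fun _ => Empty⟩

/-- The term `f t`. -/
def app {α : Type} (t : lang.Term α) : lang.Term α :=
  Functions.apply₁ (Func.f : lang.Functions 1) t

/-- `f` is injective: `∀ x y, f x = f y → x = y`. -/
def injSentence : lang.Sentence :=
  ∀' ∀' ((app &0 =' app &1) ⟹ ((&0 : lang.Term (Empty ⊕ Fin 2)) =' &1))

/-- Exactly `N` elements are not in the range of `f`: there are pairwise distinct `c₁, …, c_N` such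
that, for all `y`, there is `x` with `f x = y` iff `y` is none of the `cᵢ`. -/
def coimageSentence (N : ℕ) : lang.Sentence :=
  BoundedFormula.exs (n := N)
    ((BoundedFormula.iInf fun p : {p : Fin N × Fin N // p.1 ≠ p.2} =>
        ∼((Term.var (Sum.inr p.1.1) : lang.Term (Empty ⊕ Fin N)) =' Term.var (Sum.inr p.1.2))) ⊓
      ∀' ((∃' (app (Term.var (Sum.inr (Fin.last (N + 1)))) =' 
            (Term.var (Sum.inr (Fin.last N).castSucc) : lang.Term (Empty ⊕ Fin (N + 2))))) ⇔
          BoundedFormula.iInf fun i : Fin N =>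
            ∼((Term.var (Sum.inr (Fin.last N)) : lang.Term (Empty ⊕ Fin (N + 1))) ='
              Term.var (Sum.inr i.castSucc))))

/-- `∀ x, f^n x ≠ x`, where `f^n` is the `n`-th iterate of `f`. -/
def acyclicSentence (n : ℕ) : lang.Sentence :=
  ∀' ∼(app^[n] &0 =' (&0 : lang.Term (Empty ⊕ Fin 1)))

/-- The theory stating that `f` is injective with exactly `N` points outside its range, and that
`f^n x ≠ x` for all `x` and all `n ≥ 1`. -/
def theory (N : ℕ) : lang.Theory :=
  {injSentence, coimageSentence N} ∪ {φ | ∃ n : ℕ, 0 < n ∧ φ = acyclicSentence n}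

variable {M : Type*} [lang.Structure M]

variable (M) in
/-- The interpretation of the function symbol `f` in `M`. -/
def interp (x : M) : M := Structure.funMap (L := lang) (n := 1) Func.f ![x]

theorem realize_app {α : Type} (t : lang.Term α) (v : α → M) :
    (app t).realize v = interp M (t.realize v) := by
  exact Term.realize_functions_apply₁

theorem realize_iterate {α : Type} (n : ℕ) (t : lang.Term α) (v : α → M) :
    (app^[n] t).realize v = (interp M)^[n] (t.realize v) := by
  induction n with
  | zero => rfl
  | succ n ih => rw [Function.iterate_succ_apply', Function.iterate_succ_apply', realize_app, ih]

theorem model_iff {N : ℕ} : M ⊨ theory N ↔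
    Function.Injective (interp M) ∧
    (∃ c : Fin N → M, Function.Injective c ∧ (Set.range (interp M))ᶜ = Set.range c) ∧
    ∀ n : ℕ, 0 < n → ∀ x : M, (interp M)^[n] x ≠ x := by
  have key : M ⊨ theory N ↔ (M ⊨ injSentence ∧ M ⊨ coimageSentence N) ∧
      ∀ n : ℕ, 0 < n → M ⊨ acyclicSentence n := by
    simp only [theory, Theory.model_iff, Set.mem_union, Set.mem_insert_iff,
      Set.mem_singleton_iff, Set.mem_ofPred_eq]
    constructor
    · exact fun h => ⟨⟨h _ (.inl (.inl rfl)), h _ (.inl (.inr rfl))⟩,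
        fun n hn => h _ (.inr ⟨n, hn, rfl⟩)⟩
    · rintro ⟨⟨h1, h2⟩, h3⟩ φ ((rfl | rfl) | ⟨n, hn, rfl⟩)
      exacts [h1, h2, h3 n hn]
  rw [key, and_assoc]
  refine and_congr ?_ (and_congr ?_ (forall₂_congr fun n hn => ?_))
  · simp [injSentence, Sentence.Realize, Formula.Realize, realize_app, Function.Injective, Fin.snoc]
  · rw [coimageSentence, Sentence.Realize, BoundedFormula.realize_exs]
    refine exists_congr fun c => BoundedFormula.realize_inf.trans (and_congr ?_ ?_)
    · simp only [BoundedFormula.realize_iInf, BoundedFormula.realize_not,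
        BoundedFormula.realize_bdEqual, Term.realize_var, Sum.elim_inr]
      exact ⟨fun h i j hij => by_contra fun hne => h ⟨(i, j), hne⟩ hij,
        fun h p hp => p.2 (h hp)⟩
    · simp only [BoundedFormula.realize_all, BoundedFormula.realize_iff,
        BoundedFormula.realize_ex, BoundedFormula.realize_bdEqual, realize_app,
        BoundedFormula.realize_iInf, BoundedFormula.realize_not, Term.realize_var, Sum.elim_inr,
        Fin.snoc_last, Fin.snoc_castSucc, Set.ext_iff, Set.mem_compl_iff, Set.mem_range]
      refine forall_congr' fun y => ?_
      rw [← not_exists, not_iff_comm, iff_comm]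
      simp only [@eq_comm _ y]
      exact iff_comm
  · simp [acyclicSentence, Sentence.Realize, Formula.Realize, realize_iterate, Fin.snoc]

theorem nontrivial_of_model {N : ℕ} (hN : 0 < N) (hM : M ⊨ theory N) : Nontrivial M := by
  obtain ⟨-, ⟨c, -, -⟩, h⟩ := model_iff.1 hM
  exact ⟨_, _, h 1 one_pos (c ⟨0, hN⟩)⟩

end NoCycles

end

/-!
For `N` points outside the range of `f`, the bijection `f : M → f(M)` gives `[M] = [M] + N`, so `N`
vanishes in `K₀(M)`. What remains is that `[M]` generates `K₀(M)` as a ring and satisfies no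
relation over `ℤ/N`.

*Constructible sets.* An atom is an equation `f ^ n p = f ^ m q` between variables or constants.
As `f` is injective and without cycles, any system of atoms can be rewritten so that a given unknown
`x_i` either does not occur or occurs in just one equation, which determines it
(`IsSystem.eliminate`). The equation `f ^ n x_i = a` is solvable unless `a` is one of `n * N` named
points, so the projection of a system is a Boolean combination of atoms (`IsSystem.exists_update`).

*Euler characteristic.* By the same token, a section of a system along one coordinate is all of `M`
or has at most one point, so that sections of constructible functions are constant off a finite set.
For such functions there is an integral that gives measure `1` to points and an arbitrary value `T`
to `M` (`integral`), and integration along a coordinate preserves constructible functions. With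
`T = -1` over `ℤ` this integral detects whether a section is empty, which gives quantifier
elimination: the definable sets are the Boolean combinations of atoms (`isConstructible_of_isDef`).
Over a ring in which `N = 0` the order of integration is immaterial (`fiberIntegral_comm`): planar
sections of systems are products, or graphs of iterates of `f`, and the range of an iterate, which
misses a multiple of `N` points, has measure `T`. Integrating the indicator function of a set along
all coordinates defines its Euler characteristic. Applied to the graph of a definable bijection,
the independence of the order yields its invariance (`eulerChar_eq_of_existsUnique`): integrate
along either factor first. For `R = (ℤ/N)[X]` and `T = X`, this is a ring homomorphism from `K₀(M)`
that maps `[M]` to `X`.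

*Generation.* A system in `n + 1` unknowns is the product of `M` with a definable subset of `M ^ n`,
or is in definable bijection with its projection to `M ^ n` (`exists_cls_system`). Induction on
the dimension shows that every class is an integral polynomial in `[M]`. The homomorphism
above reduces the coefficients of this polynomial modulo `N`, so its kernel is trivial.
-/
noncomputable section

open Set

/-! ### Atoms, systems of equations and constructible sets -/

/-- `f` is an injective self-map of `M` without cycles, and `c` enumerates without repetition the
`N` points outside its range. -/
structure IsAcyclicShift {M : Type*} {N : ℕ} (f : M → M) (c : Fin N → M) : Prop where
  injective : Function.Injective f
  injective_points : Function.Injective c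
  compl_range : (range f)ᶜ = range c
  iterate_ne : ∀ n : ℕ, 0 < n → ∀ x, f^[n] x ≠ x

namespace ShiftSets

variable {M : Type*} {α β : Type*} {f : M → M}

/-- The value at `v` of an element of `α ⊕ M`, which is either a variable or a constant. -/
def val (p : α ⊕ M) (v : α → M) : M := Sum.elim v id p

@[simp] theorem val_inl (i : α) (v : α → M) : val (.inl i) v = v i := rfl

@[simp] theorem val_inr (a : M) (v : α → M) : val (.inr a : α ⊕ M) v = a := rfl

theorem val_update [DecidableEq α] {p : α ⊕ M} {i : α} (hp : p ≠ .inl i) (v : α → M) (y : M) :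
    val p (Function.update v i y) = val p v := by
  rcases p with j | a
  · exact Function.update_of_ne (fun h => hp (by rw [h])) _ _
  · rfl

/-- The atomic set `f ^ n p = f ^ m q`, where each of `p` and `q` is a variable or a constant. -/
def atom (f : M → M) (n : ℕ) (p : α ⊕ M) (m : ℕ) (q : α ⊕ M) : Set (α → M) :=
  {v | f^[n] (val p v) = f^[m] (val q v)}

theorem mem_atom {n m : ℕ} {p q : α ⊕ M} {v : α → M} :
    v ∈ atom f n p m q ↔ f^[n] (val p v) = f^[m] (val q v) := Iff.rfl

/-- A solution set of a finite system of atomic equations. -/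
inductive IsSystem (f : M → M) : Set (α → M) → Prop
  | univ : IsSystem f univ
  | inter (n : ℕ) (p : α ⊕ M) (m : ℕ) (q : α ⊕ M) {B : Set (α → M)} :
      IsSystem f B → IsSystem f (atom f n p m q ∩ B)

/-- The Boolean combinations of atomic sets, presented as decision trees whose tests are atoms. -/
inductive IsConstructible (f : M → M) : Set (α → M) → Prop
  | empty : IsConstructible f ∅
  | univ : IsConstructible f univ
  | ite (n : ℕ) (p : α ⊕ M) (m : ℕ) (q : α ⊕ M) {S T : Set (α → M)} :
      IsConstructible f S → IsConstructible f T → IsConstructible f ((atom f n p m q).ite S T)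

namespace IsConstructible

variable {S T : Set (α → M)}

theorem atom (n : ℕ) (p : α ⊕ M) (m : ℕ) (q : α ⊕ M) : IsConstructible f (atom f n p m q) := by
  simpa using IsConstructible.ite n p m q .univ (.empty (f := f))

theorem inter (hS : IsConstructible f S) (hT : IsConstructible f T) :
    IsConstructible f (S ∩ T) := by
  induction hS with
  | empty => simpa using empty
  | univ => simpa using hT
  | ite n p m q _ _ h1 h2 =>
    convert ite n p m q h1 h2 using 1
    ext v; simp only [Set.ite, mem_union, mem_inter_iff, Set.mem_sdiff]; tauto

theorem compl (hS : IsConstructible f S) : IsConstructible f Sᶜ := by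
  induction hS with
  | empty => simpa using univ
  | univ => simpa using empty
  | ite n p m q _ _ h1 h2 =>
    convert ite n p m q h1 h2 using 1
    ext v; simp only [Set.ite, mem_union, mem_inter_iff, Set.mem_sdiff, mem_compl_iff]; tauto

theorem union (hS : IsConstructible f S) (hT : IsConstructible f T) :
    IsConstructible f (S ∪ T) := by
  simpa [compl_inter] using (hS.compl.inter hT.compl).compl

theorem iUnion {ι : Type*} {s : Set ι} (hs : s.Finite) {S : ι → Set (α → M)}
    (hS : ∀ i, IsConstructible f (S i)) : IsConstructible f (⋃ i ∈ s, S i) := by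
  induction s, hs using Set.Finite.induction_on with
  | empty => simpa using empty
  | insert _ _ ih => simpa using (hS _).union ih

/-- Constructible sets are stable under the substitution of variables or constants for the
variables. -/
theorem subst (hS : IsConstructible f S) (g : α → β ⊕ M) :
    IsConstructible f {v : β → M | (fun i => val (g i) v) ∈ S} := by
  induction hS with
  | empty => exact empty
  | univ => exact univ
  | ite n p m q _ _ h1 h2 =>
    have hval : ∀ (p : α ⊕ M) (v : β → M),
        val p (fun i => val (g i) v) = val (Sum.elim g Sum.inr p) v := by
      rintro (i | a) v <;> rfl
    convert ite n (Sum.elim g Sum.inr p) m (Sum.elim g Sum.inr q) h1 h2 using 1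
    ext v
    simp only [Set.ite, mem_union, mem_inter_iff, Set.mem_sdiff, mem_ofPred_eq, mem_atom, hval]

end IsConstructible

variable [DecidableEq α]

/-- The set `B` is a cylinder in the direction of the coordinate `i`: membership does not depend
on that coordinate. -/
def IsFree (i : α) (B : Set (α → M)) : Prop := ∀ v y, Function.update v i y ∈ B ↔ v ∈ B

theorem IsFree.inter {i : α} {A B : Set (α → M)} (hA : IsFree i A) (hB : IsFree i B) :
    IsFree i (A ∩ B) := fun v y => and_congr (hA v y) (hB v y)

theorem isFree_atom {i : α} {p q : α ⊕ M} (hp : p ≠ .inl i) (hq : q ≠ .inl i) (n m : ℕ) :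
    IsFree i (atom f n p m q) := fun v y => by
  simp only [mem_atom, val_update hp, val_update hq]

theorem iterate_eq_iterate_iff {N : ℕ} {c : Fin N → M} (hf : IsAcyclicShift f c) {n m : ℕ} {x : M} :
    f^[n] x = f^[m] x ↔ n = m := by
  refine ⟨fun h => ?_, fun h => by rw [h]⟩
  wlog hnm : n ≤ m generalizing n m
  · exact (this h.symm (by omega)).symm
  obtain ⟨k, rfl⟩ := Nat.exists_eq_add_of_le hnm
  rw [Function.iterate_add_apply] at h
  rcases Nat.eq_zero_or_pos k with rfl | hk
  · rfl
  · exact (hf.iterate_ne k hk x (hf.injective.iterate n h).symm).elim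

/-- Relative to a coordinate `i`, an atom is either free of `i` or an equation for it. -/
theorem atom_cases {N : ℕ} {c : Fin N → M} (hf : IsAcyclicShift f c) (i : α) (n : ℕ) (p : α ⊕ M)
    (m : ℕ) (q : α ⊕ M) : IsFree i (atom f n p m q) ∨
      ∃ n' m' q', q' ≠ .inl i ∧ atom f n p m q = atom f n' (.inl i) m' q' := by
  by_cases hp : p = .inl i <;> by_cases hq : q = .inl i
  · subst hp hq
    left
    intro v y
    simp only [mem_atom, iterate_eq_iterate_iff hf]
  · subst hp
    exact .inr ⟨n, m, q, hq, rfl⟩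
  · subst hq
    exact .inr ⟨m, n, p, hp, by ext; simp only [mem_atom]; exact eq_comm⟩
  · exact .inl (isFree_atom hp hq n m)

/-- A system of equations is equivalent to one in which the coordinate `i` occurs at most once: two
equations for the same unknown amount to one of them together with an equation that does not
involve the unknown. -/
theorem IsSystem.eliminate {N : ℕ} {c : Fin N → M} (hf : IsAcyclicShift f c) (i : α)
    {B : Set (α → M)} (hB : IsSystem f B) :
    IsFree i B ∨ ∃ B₀ n m q, IsSystem f B₀ ∧ IsFree i B₀ ∧ q ≠ .inl i ∧
      B = B₀ ∩ atom f n (.inl i) m q := by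
  induction hB with
  | univ => exact .inl fun _ _ => Iff.rfl
  | @inter n p m q B hB ih =>
    rcases atom_cases hf i n p m q with h | ⟨n', m', q', hq', h⟩
    · rcases ih with ih | ⟨B₀, n₁, m₁, q₁, h1, h2, h3, rfl⟩
      · exact .inl (h.inter ih)
      · exact .inr ⟨_, n₁, m₁, q₁, h1.inter n p m q, h.inter h2, h3, (inter_assoc _ _ _).symm⟩
    · rw [h]
      rcases ih with ih | ⟨B₀, n₁, m₁, q₁, h1, h2, h3, rfl⟩
      · exact .inr ⟨B, n', m', q', hB, ih, hq', inter_comm _ _⟩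
      · refine .inr ⟨_, n₁, m₁, q₁, h1.inter (n' + m₁) q₁ (n₁ + m') q',
          (isFree_atom h3 hq' _ _).inter h2, h3, ?_⟩
        ext v
        simp only [mem_inter_iff, mem_atom, val_inl]
        have key (hv : f^[n₁] (v i) = f^[m₁] (val q₁ v)) : f^[n'] (v i) = f^[m'] (val q' v) ↔
            f^[n' + m₁] (val q₁ v) = f^[n₁ + m'] (val q' v) := by
          rw [Function.iterate_add_apply f n' m₁, ← hv, ← Function.iterate_add_apply,
            Nat.add_comm n' n₁, Function.iterate_add_apply, Function.iterate_add_apply,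
            (hf.injective.iterate n₁).eq_iff]
        tauto

/-! ### Integration of almost constant functions -/

section Integral

variable (R M : Type*) [CommRing R]

/-- The functions `M → R` that are constant off a finite set. -/
def almostConst : Submodule R (M → R) where
  carrier := {φ | ∃ r, ∀ᶠ x in Filter.cofinite, φ x = r}
  zero_mem' := ⟨0, .of_forall fun _ => rfl⟩
  add_mem' := by
    rintro φ ψ ⟨r, hr⟩ ⟨s, hs⟩
    exact ⟨r + s, by filter_upwards [hr, hs] with x h1 h2; simp [h1, h2]⟩
  smul_mem' := by
    rintro a φ ⟨r, hr⟩
    exact ⟨a * r, by filter_upwards [hr] with x h1; simp [h1]⟩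

variable {R M}

theorem const_mem_almostConst (r : R) : (fun _ : M => r) ∈ almostConst R M :=
  ⟨r, .of_forall fun _ => rfl⟩

theorem indicator_mem_almostConst {P : Set M} (hP : P.Finite) :
    P.indicator 1 ∈ almostConst R M :=
  ⟨0, by filter_upwards [hP.compl_mem_cofinite] with x hx using indicator_of_notMem hx _⟩

theorem indicator_mem_almostConst_of_or {P : Set M} (hP : P = univ ∨ P.Subsingleton) :
    P.indicator 1 ∈ almostConst R M := by
  rcases hP with rfl | hP
  · rw [indicator_univ]
    exact const_mem_almostConst 1
  · exact indicator_mem_almostConst hP.finite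

/-- The integral of an almost constant function on `M` for the finitely additive measure that gives
measure `1` to points and measure `T` to `M`: if `φ` takes the value `r` almost everywhere, it is
`r * T + ∑ (φ x - r)`. The value is `0` if `φ` is not almost constant. -/
def integral (T : R) (φ : M → R) : R :=
  open Classical in
  if h : ∃ r, ∀ᶠ x in Filter.cofinite, φ x = r then h.choose * T + ∑ᶠ x, (φ x - h.choose) else 0

variable {T : R} {φ ψ : M → R}

theorem finite_support_sub {r : R} (h : ∀ᶠ x in Filter.cofinite, φ x = r) :
    (Function.support fun x => φ x - r).Finite := by
  refine (Filter.eventually_cofinite.1 h).subset fun x hx => ?_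
  simpa [sub_eq_zero] using hx

variable [Infinite M]

theorem integral_eq {r : R} (h : ∀ᶠ x in Filter.cofinite, φ x = r) :
    integral T φ = r * T + ∑ᶠ x, (φ x - r) := by
  have hex : ∃ r, ∀ᶠ x in Filter.cofinite, φ x = r := ⟨r, h⟩
  obtain ⟨x, hx1, hx2⟩ := (h.and hex.choose_spec).exists
  have key : hex.choose = r := hx2.symm.trans hx1
  rw [integral, dif_pos hex, key]

theorem integral_add (hφ : φ ∈ almostConst R M) (hψ : ψ ∈ almostConst R M) :
    integral T (φ + ψ) = integral T φ + integral T ψ := by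
  obtain ⟨r, hr⟩ := hφ
  obtain ⟨s, hs⟩ := hψ
  have h : ∀ᶠ x in Filter.cofinite, (φ + ψ) x = r + s := by
    filter_upwards [hr, hs] with x h1 h2
    simp [h1, h2]
  have h' : ∀ x, (φ + ψ) x - (r + s) = (φ x - r) + (ψ x - s) := fun x => by
    rw [Pi.add_apply]; ring
  rw [integral_eq h, integral_eq hr, integral_eq hs, finsum_congr h',
    finsum_add_distrib (finite_support_sub hr) (finite_support_sub hs)]
  ring

theorem integral_smul (a : R) (hφ : φ ∈ almostConst R M) :
    integral T (a • φ) = a * integral T φ := by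
  obtain ⟨r, hr⟩ := hφ
  have h : ∀ᶠ x in Filter.cofinite, (a • φ) x = a * r := by
    filter_upwards [hr] with x h1
    simp [h1]
  have h' : ∀ x, (a • φ) x - a * r = a * (φ x - r) := fun x => by
    rw [Pi.smul_apply, smul_eq_mul]; ring
  rw [integral_eq h, integral_eq hr, finsum_congr h', ← mul_finsum' _ _ (finite_support_sub hr)]
  ring

theorem integral_const (r : R) : integral T (fun _ : M => r) = r * T := by
  rw [integral_eq (r := r) (.of_forall fun _ => rfl)]
  simp

theorem integral_indicator_finite {P : Set M} (hP : P.Finite) :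
    integral T (P.indicator 1) = (P.ncard : R) := by
  rw [integral_eq (r := 0)
    (by filter_upwards [hP.compl_mem_cofinite] with x hx using indicator_of_notMem hx _)]
  simp only [zero_mul, sub_zero, zero_add]
  have h : ∀ x, P.indicator (1 : M → R) x = ∑ᶠ (_ : x ∈ P), 1 := fun x => by
    by_cases hx : x ∈ P <;> simp [hx]
  rw [finsum_congr h, finsum_mem_eq_finite_toFinset_sum _ hP, ncard_eq_toFinset_card P hP]
  simp

theorem integral_indicator_singleton (a : M) : integral T (({a} : Set M).indicator 1) = 1 := by
  rw [integral_indicator_finite (finite_singleton a)]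
  simp

theorem integral_indicator_compl {P : Set M} (hP : P.Finite) :
    integral T (Pᶜ.indicator 1) = T - P.ncard := by
  have h : (Pᶜ.indicator 1 : M → R) = (fun _ => 1) + (-1 : R) • P.indicator 1 := by
    ext x
    by_cases hx : x ∈ P <;> simp [hx]
  rw [h, integral_add (const_mem_almostConst 1)
    (Submodule.smul_mem _ _ (indicator_mem_almostConst hP)), integral_const,
    integral_smul _ (indicator_mem_almostConst hP), integral_indicator_finite hP]
  ring

theorem integral_indicator_subsingleton {P : Set M} (hP : P.Subsingleton) :
    integral T (P.indicator 1) = ({Q : Set M | Q.Nonempty}.indicator 1 P : R) := by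
  rcases hP.eq_empty_or_singleton with rfl | ⟨a, rfl⟩
  · rw [integral_indicator_finite finite_empty]
    simp
  · rw [integral_indicator_singleton]
    simp

end Integral

/-! ### The range of the iterates -/

section Range

variable {M : Type*} {N : ℕ} {f : M → M} {c : Fin N → M}

theorem notMem_range_iterate_iff (hf : IsAcyclicShift f c) (n : ℕ) (x : M) :
    x ∉ range f^[n] ↔ ∃ k ∈ Iio n, ∃ j, x = f^[k] (c j) := by
  induction n generalizing x with
  | zero => simp
  | succ n ih =>
    by_cases hx : x ∈ range f
    · obtain ⟨y, rfl⟩ := hx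
      have h1 : f y ∉ range f^[n + 1] ↔ y ∉ range f^[n] := by
        simp only [mem_range, Function.iterate_succ_apply', hf.injective.eq_iff]
      rw [h1, ih]
      constructor
      · rintro ⟨k, hk, j, rfl⟩
        exact ⟨k + 1, Nat.succ_lt_succ hk, j, (Function.iterate_succ_apply' f k _).symm⟩
      · rintro ⟨k, hk, j, hj⟩
        cases k with
        | zero =>
          have : c j ∈ (range f)ᶜ := hf.compl_range ▸ mem_range_self j
          exact (this ⟨y, hj⟩).elim
        | succ k =>
          rw [Function.iterate_succ_apply', hf.injective.eq_iff] at hj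
          exact ⟨k, Nat.lt_of_succ_lt_succ hk, j, hj⟩
    · obtain ⟨j, rfl⟩ : x ∈ range c := hf.compl_range ▸ hx
      refine iff_of_true ?_ ⟨0, Nat.succ_pos n, j, rfl⟩
      rintro ⟨y, hy⟩
      exact hx ⟨f^[n] y, by rw [← hy, Function.iterate_succ_apply']⟩

theorem infinite [Nonempty M] (hf : IsAcyclicShift f c) : Infinite M :=
  Infinite.of_injective (fun n => f^[n] (Classical.arbitrary M))
    fun _ _ h => (iterate_eq_iterate_iff hf).1 h

theorem finite_compl_range_iterate (hf : IsAcyclicShift f c) (n : ℕ) : (range f^[n])ᶜ.Finite := by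
  have : (range f^[n])ᶜ ⊆ ⋃ k ∈ Iio n, range fun j => f^[k] (c j) := fun x hx => by
    obtain ⟨k, hk, j, rfl⟩ := (notMem_range_iterate_iff hf n x).1 hx
    exact mem_biUnion hk ⟨j, rfl⟩
  exact ((finite_Iio n).biUnion fun k _ => finite_range _).subset this

theorem ncard_compl_range_iterate (hf : IsAcyclicShift f c) (n : ℕ) :
    (range f^[n])ᶜ.ncard = n * N := by
  induction n with
  | zero => simp
  | succ n ih =>
    have h : (range f^[n + 1])ᶜ = range c ∪ f '' (range f^[n])ᶜ := by
      rw [← hf.compl_range, Function.iterate_succ', range_comp]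
      ext x
      by_cases hx : x ∈ range f
      · obtain ⟨y, rfl⟩ := hx
        simp [hf.injective.eq_iff]
      · refine iff_of_true (fun h => hx (image_subset_range _ _ h)) (.inl hx)
    rw [h, ncard_union_eq ?_ (finite_range c) ((finite_compl_range_iterate hf n).image f),
      ncard_image_of_injective _ hf.injective, ih, ← Nat.card_coe_set_eq,
      Nat.card_range_of_injective hf.injective_points, Nat.card_fin, Nat.succ_mul, Nat.add_comm]
    rw [← hf.compl_range]
    exact disjoint_compl_left.mono_right (image_subset_range _ _)

end Range

/-! ### Interchanging the order of integration -/

section Fubini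

variable {R M : Type*} [CommRing R] [Infinite M] {N : ℕ} {f : M → M} {c : Fin N → M}

variable (M) in
/-- The functions of two variables whose two iterated integrals are made up of almost constant
functions only, and agree. -/
def fubini (T : R) : Submodule R (M → M → R) where
  carrier := {φ | (∀ x, φ x ∈ almostConst R M) ∧ (∀ y, (fun x => φ x y) ∈ almostConst R M) ∧
    (fun x => integral T (φ x)) ∈ almostConst R M ∧
    (fun y => integral T fun x => φ x y) ∈ almostConst R M ∧
    integral T (fun x => integral T (φ x)) = integral T fun y => integral T fun x => φ x y}
  zero_mem' := by
    have h0 : (fun _ => 0 : M → R) ∈ almostConst R M := const_mem_almostConst 0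
    have h : (fun _ => integral T fun _ : M => 0 : M → R) ∈ almostConst R M :=
      const_mem_almostConst _
    exact ⟨fun _ => h0, fun _ => h0, h, h, rfl⟩
  add_mem' := by
    rintro φ ψ ⟨h1, h2, h3, h4, h5⟩ ⟨k1, k2, k3, k4, k5⟩
    have e1 : (fun x => integral T ((φ + ψ) x)) =
        (fun x => integral T (φ x)) + fun x => integral T (ψ x) :=
      funext fun x => integral_add (h1 x) (k1 x)
    have e2 : (fun y => integral T fun x => (φ + ψ) x y) =
        (fun y => integral T fun x => φ x y) + fun y => integral T fun x => ψ x y :=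
      funext fun y => integral_add (h2 y) (k2 y)
    refine ⟨fun x => add_mem (h1 x) (k1 x), fun y => add_mem (h2 y) (k2 y), ?_, ?_, ?_⟩
    · rw [e1]; exact add_mem h3 k3
    · rw [e2]; exact add_mem h4 k4
    · rw [e1, e2, integral_add h3 k3, integral_add h4 k4, h5, k5]
  smul_mem' := by
    rintro a φ ⟨h1, h2, h3, h4, h5⟩
    have e1 : (fun x => integral T ((a • φ) x)) = a • fun x => integral T (φ x) :=
      funext fun x => integral_smul a (h1 x)
    have e2 : (fun y => integral T fun x => (a • φ) x y) =
        a • fun y => integral T fun x => φ x y :=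
      funext fun y => integral_smul a (h2 y)
    refine ⟨fun x => Submodule.smul_mem _ a (h1 x), fun y => Submodule.smul_mem _ a (h2 y),
      ?_, ?_, ?_⟩
    · rw [e1]; exact Submodule.smul_mem _ a h3
    · rw [e2]; exact Submodule.smul_mem _ a h4
    · rw [e1, e2, integral_smul a h3, integral_smul a h4, h5]

/-- The subsets of `M × M` that are products of factors `M` or with at most one element, or graphs
of iterates of `f`, or transposes of such graphs. These are the planar sections of systems of
equations. -/
inductive IsPlanar (f : M → M) : Set (M × M) → Prop
  | prod {P Q : Set M} : P = univ ∨ P.Subsingleton → Q = univ ∨ Q.Subsingleton →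
      IsPlanar f (P ×ˢ Q)
  | graph (n : ℕ) : IsPlanar f {z | z.2 = f^[n] z.1}
  | graph_swap (n : ℕ) : IsPlanar f {z | z.1 = f^[n] z.2}

theorem mem_fubini_of_swap {T : R} {φ : M → M → R} (h : (fun y x => φ x y) ∈ fubini M T) :
    φ ∈ fubini M T :=
  ⟨h.2.1, h.1, h.2.2.2.1, h.2.2.1, h.2.2.2.2.symm⟩

/-- The one place where `N = 0` in `R` matters: the graph of `f ^ n` has measure `T` when
fibred over its source, and the measure of the range of `f ^ n`, which misses `n * N` points, when
fibred over its target. -/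
theorem graph_mem_fubini (hf : IsAcyclicShift f c) (hN : (N : R) = 0) (T : R) (n : ℕ) :
    (fun x y => {z : M × M | z.2 = f^[n] z.1}.indicator (1 : M × M → R) (x, y)) ∈ fubini M T := by
  have h1 : ∀ x, (fun y => {z : M × M | z.2 = f^[n] z.1}.indicator (1 : M × M → R) (x, y)) =
      ({f^[n] x} : Set M).indicator 1 := fun x => rfl
  have h2 : ∀ y, (fun x => {z : M × M | z.2 = f^[n] z.1}.indicator (1 : M × M → R) (x, y)) =
      {x | y = f^[n] x}.indicator 1 := fun x => rfl
  have h3 : ∀ y, {x | y = f^[n] x}.Subsingleton := fun y x hx x' hx' =>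
    hf.injective.iterate n (hx.symm.trans hx')
  have e1 : (fun x => integral T fun y =>
      {z : M × M | z.2 = f^[n] z.1}.indicator (1 : M × M → R) (x, y)) = fun _ => 1 := by
    ext x
    rw [h1, integral_indicator_singleton]
  have e2 : (fun y => integral T fun x =>
      {z : M × M | z.2 = f^[n] z.1}.indicator (1 : M × M → R) (x, y)) =
      (range f^[n])ᶜᶜ.indicator 1 := by
    ext y
    rw [h2, integral_indicator_subsingleton (h3 y), compl_compl]
    by_cases hy : y ∈ range f^[n]
    · have : {x | y = f^[n] x}.Nonempty := hy.imp fun _ h => h.symm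
      simp [indicator, hy, this]
    · have : ¬ {x | y = f^[n] x}.Nonempty := fun ⟨x, hx⟩ => hy ⟨x, hx.symm⟩
      simp only [indicator, hy, mem_ofPred_eq, this, if_false]
  have hfin := finite_compl_range_iterate hf n
  refine ⟨fun x => ?_, fun y => ?_, ?_, ?_, ?_⟩
  · beta_reduce; rw [h1]; exact indicator_mem_almostConst (finite_singleton _)
  · rw [h2]; exact indicator_mem_almostConst (h3 y).finite
  · rw [e1]; exact const_mem_almostConst 1
  · rw [e2]
    exact ⟨1, by filter_upwards [hfin.compl_mem_cofinite] with x hx using indicator_of_mem hx _⟩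
  · rw [e1, e2, integral_const, integral_indicator_compl hfin, ncard_compl_range_iterate hf]
    simp [hN]

theorem IsPlanar.mem_fubini (hf : IsAcyclicShift f c) (hN : (N : R) = 0) (T : R) {A : Set (M × M)}
    (hA : IsPlanar f A) : (fun x y => A.indicator (1 : M × M → R) (x, y)) ∈ fubini M T := by
  induction hA with
  | @prod P Q hP hQ =>
    have hP' := indicator_mem_almostConst_of_or (R := R) hP
    have hQ' := indicator_mem_almostConst_of_or (R := R) hQ
    have h1 : ∀ x, (fun y => (P ×ˢ Q).indicator (1 : M × M → R) (x, y)) =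
        P.indicator (1 : M → R) x • Q.indicator (1 : M → R) := fun x => by
      ext y
      by_cases hx : x ∈ P <;> by_cases hy : y ∈ Q <;> simp [hx, hy]
    have h2 : ∀ y, (fun x => (P ×ˢ Q).indicator (1 : M × M → R) (x, y)) =
        Q.indicator (1 : M → R) y • P.indicator (1 : M → R) := fun y => by
      ext x
      by_cases hx : x ∈ P <;> by_cases hy : y ∈ Q <;> simp [hx, hy]
    have e1 : (fun x => integral T fun y => (P ×ˢ Q).indicator (1 : M × M → R) (x, y)) =
        integral T (Q.indicator (1 : M → R)) • P.indicator (1 : M → R) := by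
      ext x
      rw [h1, integral_smul _ hQ', Pi.smul_apply, smul_eq_mul, mul_comm]
    have e2 : (fun y => integral T fun x => (P ×ˢ Q).indicator (1 : M × M → R) (x, y)) =
        integral T (P.indicator (1 : M → R)) • Q.indicator (1 : M → R) := by
      ext y
      rw [h2, integral_smul _ hP', Pi.smul_apply, smul_eq_mul, mul_comm]
    refine ⟨fun x => ?_, fun y => ?_, ?_, ?_, ?_⟩
    · beta_reduce; rw [h1]; exact Submodule.smul_mem _ _ hQ'
    · rw [h2]; exact Submodule.smul_mem _ _ hP'
    · rw [e1]; exact Submodule.smul_mem _ _ hP'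
    · rw [e2]; exact Submodule.smul_mem _ _ hQ'
    · rw [e1, e2, integral_smul _ hP', integral_smul _ hQ', mul_comm]
  | graph n => exact graph_mem_fubini hf hN T n
  | graph_swap n => exact mem_fubini_of_swap (graph_mem_fubini hf hN T n)

end Fubini
section Planar

variable {M α : Type*} {N : ℕ} {f : M → M} {c : Fin N → M}

theorem IsPlanar.of_subsingleton {A : Set (M × M)} (hA : A.Subsingleton) : IsPlanar f A := by
  rcases hA.eq_empty_or_singleton with rfl | ⟨⟨a, b⟩, rfl⟩
  · rw [← prod_empty (s := (univ : Set M))]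
    exact .prod (.inl rfl) (.inr subsingleton_empty)
  · rw [← singleton_prod_singleton]
    exact .prod (.inr subsingleton_singleton) (.inr subsingleton_singleton)

theorem IsPlanar.swap {A : Set (M × M)} (hA : IsPlanar f A) : IsPlanar f (Prod.swap ⁻¹' A) := by
  cases hA with
  | prod hP hQ => rw [preimage_swap_prod]; exact .prod hQ hP
  | graph n => exact .graph_swap n
  | graph_swap n => exact .graph n

theorem IsPlanar.graph_inter (hf : IsAcyclicShift f c) (n : ℕ) {A : Set (M × M)}
    (hA : IsPlanar f A) : IsPlanar f ({z | z.2 = f^[n] z.1} ∩ A) := by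
  cases hA with
  | @prod P Q hP hQ =>
    rcases hP with rfl | hP
    · rcases hQ with rfl | hQ
      · rw [univ_prod_univ, inter_univ]
        exact .graph n
      · refine .of_subsingleton ?_
        rintro ⟨x, y⟩ ⟨h1, -, h2⟩ ⟨x', y'⟩ ⟨h1', -, h2'⟩
        obtain rfl : y = y' := hQ h2 h2'
        exact Prod.ext (hf.injective.iterate n (h1.symm.trans h1')) rfl
    · refine .of_subsingleton ?_
      rintro ⟨x, y⟩ ⟨h1, h2, -⟩ ⟨x', y'⟩ ⟨h1', h2', -⟩
      obtain rfl : x = x' := hP h2 h2'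
      exact Prod.ext rfl (h1.trans h1'.symm)
  | graph m =>
    by_cases hnm : n = m
    · subst hnm
      rw [inter_self]
      exact .graph n
    · refine .of_subsingleton ?_
      rintro ⟨x, y⟩ ⟨h1, h2⟩
      exact (hnm ((iterate_eq_iterate_iff hf).1 (h1.symm.trans h2))).elim
  | graph_swap m =>
    by_cases hnm : m + n = 0
    · obtain ⟨rfl, rfl⟩ := Nat.add_eq_zero_iff.1 hnm
      convert IsPlanar.graph 0 using 1
      ext ⟨x, y⟩
      simp [eq_comm]
    · refine .of_subsingleton ?_
      rintro ⟨x, y⟩ ⟨h1, h2⟩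
      simp only [mem_ofPred_eq] at h1 h2
      rw [h1, ← Function.iterate_add_apply] at h2
      exact (hf.iterate_ne _ (Nat.pos_of_ne_zero hnm) x h2.symm).elim

theorem IsPlanar.inter (hf : IsAcyclicShift f c) {A B : Set (M × M)}
    (hA : IsPlanar f A) (hB : IsPlanar f B) : IsPlanar f (A ∩ B) := by
  have key : ∀ {P Q : Set M}, P = univ ∨ P.Subsingleton → Q = univ ∨ Q.Subsingleton →
      P ∩ Q = univ ∨ (P ∩ Q).Subsingleton := by
    rintro P Q (rfl | hP) hQ
    · simpa using hQ
    · exact .inr (hP.anti inter_subset_left)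
  cases hA with
  | prod hP hQ =>
    cases hB with
    | prod hP' hQ' => rw [prod_inter_prod]; exact .prod (key hP hP') (key hQ hQ')
    | graph n => rw [inter_comm]; exact (IsPlanar.prod hP hQ).graph_inter hf n
    | graph_swap n => rw [inter_comm]; exact ((IsPlanar.prod hP hQ).swap.graph_inter hf n).swap
  | graph n => exact hB.graph_inter hf n
  | graph_swap n => exact (hB.swap.graph_inter hf n).swap

variable [DecidableEq α]

theorem isPlanar_section_iterate (hf : IsAcyclicShift f c) (i j : α) (v : α → M)
    (k : ℕ) (p q : α ⊕ M) : IsPlanar f {z : M × M |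
      val q (Function.update (Function.update v i z.1) j z.2) =
        f^[k] (val p (Function.update (Function.update v i z.1) j z.2))} := by
  have hval : ∀ p : α ⊕ M,
      (∀ z : M × M, val p (Function.update (Function.update v i z.1) j z.2) = z.1) ∨
      (∀ z : M × M, val p (Function.update (Function.update v i z.1) j z.2) = z.2) ∨
      ∃ a, ∀ z : M × M, val p (Function.update (Function.update v i z.1) j z.2) = a := by
    intro p
    by_cases hj : p = .inl j
    · exact .inr (.inl fun z => by simp [hj])
    by_cases hi : p = .inl i
    · exact .inl fun z => by rw [val_update hj, hi, val_inl, Function.update_self]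
    · exact .inr (.inr ⟨val p v, fun z => by rw [val_update hj, val_update hi]⟩)
  have hconst : ∀ P : Prop, IsPlanar f {_z : M × M | P} := fun P => by
    by_cases hP : P
    · convert IsPlanar.prod (f := f) (.inl (rfl : (univ : Set M) = univ)) (.inl rfl) using 1
      simp [hP]
    · refine .of_subsingleton ?_
      rintro z hz
      exact (hP hz).elim
  have hfst : ∀ P : Set M, P.Subsingleton → IsPlanar f {z : M × M | z.1 ∈ P} := fun P hP => by
    convert IsPlanar.prod (f := f) (.inr hP) (.inl (rfl : (univ : Set M) = univ)) using 1
    ext; simp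
  have hsnd : ∀ P : Set M, P.Subsingleton → IsPlanar f {z : M × M | z.2 ∈ P} :=
    fun P hP => (hfst P hP).swap
  have hinj : ∀ b, {x | b = f^[k] x}.Subsingleton := fun b x hx y hy =>
    hf.injective.iterate k (hx.symm.trans hy)
  have hk : ∀ x, x = f^[k] x ↔ 0 = k := fun x => iterate_eq_iterate_iff (n := 0) hf
  rcases hval p with hp | hp | ⟨a, hp⟩ <;> rcases hval q with hq | hq | ⟨b, hq⟩ <;>
    simp only [hp, hq]
  · simp only [hk]; exact hconst _
  · exact .graph k
  · exact hfst _ (hinj b)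
  · exact .graph_swap k
  · simp only [hk]; exact hconst _
  · exact hsnd _ (hinj b)
  · exact hfst {f^[k] a} subsingleton_singleton
  · exact hsnd {f^[k] a} subsingleton_singleton
  · exact hconst _

theorem iterate_eq_iterate_add_iff (hf : IsAcyclicShift f c) (n k : ℕ) (x y : M) :
    f^[n] x = f^[n + k] y ↔ x = f^[k] y := by
  rw [Function.iterate_add_apply, (hf.injective.iterate n).eq_iff]

/-- Every planar section of a system of equations is of one of the types listed in `IsPlanar`. -/
theorem IsSystem.isPlanar_section (hf : IsAcyclicShift f c) (i j : α) (v : α → M)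
    {B : Set (α → M)} (hB : IsSystem f B) :
    IsPlanar f {z : M × M | Function.update (Function.update v i z.1) j z.2 ∈ B} := by
  induction hB with
  | univ => simpa using IsPlanar.prod (f := f) (.inl (rfl : (Set.univ : Set M) = _)) (.inl rfl)
  | inter n p m q _ ih =>
    refine IsPlanar.inter hf ?_ ih
    change IsPlanar f {z : M × M | _ = _}
    rcases le_total n m with h | h <;> obtain ⟨k, rfl⟩ := Nat.exists_eq_add_of_le h
    · simp only [iterate_eq_iterate_add_iff hf]
      exact isPlanar_section_iterate hf i j v k q p
    · simp only [eq_comm (a := f^[m + k] _), iterate_eq_iterate_add_iff hf]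
      exact isPlanar_section_iterate hf i j v k p q

end Planar

/-! ### Constructible functions and integration along a coordinate -/

section ConstructibleFun

variable {R M α β : Type*} [CommRing R] {N : ℕ} {f : M → M} {c : Fin N → M}

theorem IsSystem.isConstructible {B : Set (α → M)} (hB : IsSystem f B) : IsConstructible f B := by
  induction hB with
  | univ => exact .univ
  | inter n p m q _ ih => exact (IsConstructible.atom n p m q).inter ih

variable (R α) in
/-- The `R`-valued constructible functions on `M ^ α`: the linear combinations of indicator
functions of systems of equations. -/
def constructibleFun (f : M → M) : Submodule R ((α → M) → R) :=
  Submodule.span R {φ | ∃ B, IsSystem f B ∧ φ = B.indicator 1}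

theorem IsSystem.indicator_mem {B : Set (α → M)} (hB : IsSystem f B) :
    B.indicator 1 ∈ constructibleFun R α f := Submodule.subset_span ⟨B, hB, rfl⟩

theorem atom_indicator_mul_mem (n : ℕ) (p : α ⊕ M) (m : ℕ) (q : α ⊕ M) {φ : (α → M) → R}
    (hφ : φ ∈ constructibleFun R α f) :
    (atom f n p m q).indicator 1 * φ ∈ constructibleFun R α f := by
  induction hφ using Submodule.span_induction with
  | mem φ h =>
    obtain ⟨B, hB, rfl⟩ := h
    rw [← inter_indicator_one]
    exact (hB.inter n p m q).indicator_mem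
  | zero => rw [mul_zero]; exact zero_mem _
  | add φ ψ _ _ h1 h2 => rw [mul_add]; exact add_mem h1 h2
  | smul a φ _ h => rw [mul_smul_comm]; exact Submodule.smul_mem _ _ h

theorem IsConstructible.indicator_mem {S : Set (α → M)} (hS : IsConstructible f S) :
    S.indicator 1 ∈ constructibleFun R α f := by
  induction hS with
  | empty => rw [indicator_empty]; exact zero_mem _
  | univ => exact IsSystem.univ.indicator_mem
  | @ite n p m q S T _ _ h1 h2 =>
    have h : (((ShiftSets.atom f n p m q).ite S T).indicator 1 : (α → M) → R) =
        (ShiftSets.atom f n p m q).indicator 1 * S.indicator 1 +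
          (T.indicator 1 - (ShiftSets.atom f n p m q).indicator 1 * T.indicator 1) := by
      ext v
      by_cases ha : v ∈ ShiftSets.atom f n p m q <;> by_cases hS : v ∈ S <;> by_cases hT : v ∈ T <;>
        simp [Set.ite, ha, hS, hT]
    rw [h]
    exact add_mem (atom_indicator_mul_mem n p m q h1)
      (sub_mem h2 (atom_indicator_mul_mem n p m q h2))

/-- A constructible function takes finitely many values, and its level sets are constructible. -/
theorem finite_range_and_isConstructible_preimage {φ : (α → M) → R}
    (hφ : φ ∈ constructibleFun R α f) :
    (range φ).Finite ∧ ∀ V : Set R, IsConstructible f (φ ⁻¹' V) := by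
  have reduce : ∀ {φ : (α → M) → R}, (range φ).Finite →
      (∀ r, IsConstructible f (φ ⁻¹' {r})) → ∀ V : Set R, IsConstructible f (φ ⁻¹' V) := by
    intro φ hfin h V
    convert IsConstructible.iUnion (hfin.inter_of_left V) h using 1
    ext v
    simp
  induction hφ using Submodule.span_induction with
  | mem φ h =>
    obtain ⟨B, hB, rfl⟩ := h
    have hfin : (range (B.indicator (1 : (α → M) → R))).Finite := by
      refine (finite_singleton (1 : R) |>.insert 0).subset ?_
      rintro _ ⟨v, rfl⟩
      by_cases hv : v ∈ B <;> simp [hv]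
    refine ⟨hfin, fun V => ?_⟩
    classical
    have := indicator_const_preimage_eq_union B V (1 : R)
    change (B.indicator fun _ => (1 : R)) ⁻¹' V = _ at this
    change IsConstructible f ((B.indicator fun _ => (1 : R)) ⁻¹' V)
    rw [this]
    refine IsConstructible.union ?_ ?_ <;> split_ifs
    exacts [hB.isConstructible, .empty, hB.isConstructible.compl, .empty]
  | zero =>
    refine ⟨(finite_singleton (0 : R)).subset (by rintro _ ⟨v, rfl⟩; rfl), fun V => ?_⟩
    by_cases h : (0 : R) ∈ V
    · convert IsConstructible.univ using 1
      ext; simp [h]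
    · convert IsConstructible.empty using 1
      ext; simp [h]
  | add φ ψ _ _ h1 h2 =>
    have hfin : (range (φ + ψ)).Finite := by
      refine (h1.1.add h2.1).subset ?_
      rintro _ ⟨v, rfl⟩
      exact add_mem_add (mem_range_self v) (mem_range_self v)
    refine ⟨hfin, reduce hfin fun r => ?_⟩
    convert IsConstructible.iUnion h1.1 fun s => (h1.2 {s}).inter (h2.2 {r - s}) using 1
    ext v
    simp only [mem_preimage, Pi.add_apply, mem_singleton_iff, mem_range, mem_iUnion,
      mem_inter_iff, eq_sub_iff_add_eq', exists_prop, exists_exists_eq_and]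
    exact ⟨fun h => ⟨v, rfl, h⟩, fun ⟨w, hw, h⟩ => hw ▸ h⟩
  | smul a φ _ h =>
    refine ⟨(h.1.image (a * ·)).subset ?_, fun V => h.2 ((a * ·) ⁻¹' V)⟩
    rintro _ ⟨v, rfl⟩
    exact ⟨_, mem_range_self v, rfl⟩

variable [DecidableEq α]

theorem IsFree.indicator_update {i : α} {B : Set (α → M)} (hB : IsFree i B) (v : α → M) (y : M) :
    B.indicator (1 : (α → M) → R) (Function.update v i y) = B.indicator 1 v := by
  by_cases hv : v ∈ B
  · rw [indicator_of_mem hv, indicator_of_mem ((hB v y).2 hv)]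
    rfl
  · rw [indicator_of_notMem hv, indicator_of_notMem (mt (hB v y).1 hv)]

theorem IsSystem.isFree_or_subsingleton (hf : IsAcyclicShift f c) (i : α) {B : Set (α → M)}
    (hB : IsSystem f B) :
    IsFree i B ∨ ∀ v : α → M, {y | Function.update v i y ∈ B}.Subsingleton := by
  rcases hB.eliminate hf i with h | ⟨B₀, n, m, q, -, -, hq, rfl⟩
  · exact .inl h
  · refine .inr fun v y hy y' hy' => hf.injective.iterate n ?_
    have h1 := hy.2
    have h2 := hy'.2
    simp only [mem_atom, val_inl, Function.update_self, val_update hq] at h1 h2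
    rw [h1, h2]

/-- The projection of a system along a coordinate `i` is constructible: the equation
`f ^ n x_i = f ^ m q` is solvable for `x_i` iff `f ^ m q` is none of the points outside the range
of `f ^ n`. -/
theorem IsSystem.exists_update (hf : IsAcyclicShift f c) (i : α) {B : Set (α → M)}
    (hB : IsSystem f B) : IsConstructible f {v | ∃ y, Function.update v i y ∈ B} := by
  rcases hB.eliminate hf i with h | ⟨B₀, n, m, q, h0, h1, hq, rfl⟩
  · convert hB.isConstructible using 1
    ext v
    exact ⟨fun ⟨y, hy⟩ => (h v y).1 hy, fun hv => ⟨v i, by simpa using hv⟩⟩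
  · convert h0.isConstructible.inter (IsConstructible.iUnion (finite_Iio n) fun k =>
      IsConstructible.iUnion (finite_univ (α := Fin N)) fun j =>
        IsConstructible.atom (f := f) m q k (.inr (c j))).compl using 1
    ext v
    have key := not_congr (notMem_range_iterate_iff hf n (f^[m] (val q v)))
    rw [not_not] at key
    simp only [mem_inter_iff, mem_ofPred_eq, h1 v, mem_atom, val_inl, Function.update_self,
      val_update hq, exists_and_left, mem_compl_iff, mem_iUnion, val_inr, mem_univ, exists_prop,
      true_and]
    exact and_congr_right fun _ => key

/-- Integration along the coordinate `i`. -/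
def fiberIntegral (T : R) (i : α) (φ : (α → M) → R) : (α → M) → R :=
  fun v => integral T fun y => φ (Function.update v i y)

theorem section_mem_almostConst (hf : IsAcyclicShift f c) {φ : (α → M) → R}
    (hφ : φ ∈ constructibleFun R α f) (i : α) (v : α → M) :
    (fun y => φ (Function.update v i y)) ∈ almostConst R M := by
  induction hφ using Submodule.span_induction with
  | mem φ h =>
    obtain ⟨B, hB, rfl⟩ := h
    rcases hB.isFree_or_subsingleton hf i with h | h
    · convert const_mem_almostConst (B.indicator (1 : (α → M) → R) v) using 1
      ext y
      exact h.indicator_update v y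
    · exact indicator_mem_almostConst (h v).finite
  | zero => exact const_mem_almostConst 0
  | add φ ψ _ _ h1 h2 => exact add_mem h1 h2
  | smul a φ _ h => exact Submodule.smul_mem _ a h

variable [Infinite M] {T : R}

theorem fiberIntegral_add (hf : IsAcyclicShift f c) {φ ψ : (α → M) → R}
    (hφ : φ ∈ constructibleFun R α f) (hψ : ψ ∈ constructibleFun R α f) (i : α) :
    fiberIntegral T i (φ + ψ) = fiberIntegral T i φ + fiberIntegral T i ψ :=
  funext fun v => integral_add (section_mem_almostConst hf hφ i v)
    (section_mem_almostConst hf hψ i v)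

theorem fiberIntegral_smul (hf : IsAcyclicShift f c) (a : R) {φ : (α → M) → R}
    (hφ : φ ∈ constructibleFun R α f) (i : α) :
    fiberIntegral T i (a • φ) = a • fiberIntegral T i φ :=
  funext fun v => integral_smul a (section_mem_almostConst hf hφ i v)

/-- If the fibres of `B` along the coordinate `i` have at most one point, integration along them
yields the indicator function of the projection. -/
theorem fiberIntegral_indicator_of_subsingleton {i : α} {B : Set (α → M)}
    (hB : ∀ v : α → M, {y | Function.update v i y ∈ B}.Subsingleton) :
    fiberIntegral T i (B.indicator 1) = {v | ∃ y, Function.update v i y ∈ B}.indicator 1 := by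
  ext v
  refine (integral_indicator_subsingleton (hB v)).trans ?_
  rfl

theorem fiberIntegral_mem (hf : IsAcyclicShift f c) {φ : (α → M) → R}
    (hφ : φ ∈ constructibleFun R α f) (i : α) :
    fiberIntegral T i φ ∈ constructibleFun R α f := by
  induction hφ using Submodule.span_induction with
  | mem φ h =>
    obtain ⟨B, hB, rfl⟩ := h
    rcases hB.isFree_or_subsingleton hf i with h | h
    · convert Submodule.smul_mem _ T hB.indicator_mem using 1
      ext v
      have : (fun y => B.indicator (1 : (α → M) → R) (Function.update v i y)) =
          fun _ => B.indicator (1 : (α → M) → R) v := by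
        ext y
        exact h.indicator_update v y
      rw [fiberIntegral, this, integral_const, Pi.smul_apply, smul_eq_mul, mul_comm]
    · rw [fiberIntegral_indicator_of_subsingleton h]
      exact (hB.exists_update hf i).indicator_mem
  | zero =>
    convert zero_mem (constructibleFun R α f) using 1
    ext v
    exact (integral_const (M := M) (T := T) 0).trans (zero_mul T)
  | add φ ψ h1 h2 ih1 ih2 => rw [fiberIntegral_add hf h1 h2]; exact add_mem ih1 ih2
  | smul a φ h ih => rw [fiberIntegral_smul hf a h]; exact Submodule.smul_mem _ a ih

/-- Projections of constructible sets are constructible. The integral with `R = ℤ` and `T = -1`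
detects nonemptiness: it is `k` for a set of `k` points, and `-1 - k` for the complement of one. -/
theorem IsConstructible.exists_update (hf : IsAcyclicShift f c) (i : α) {S : Set (α → M)}
    (hS : IsConstructible f S) : IsConstructible f {v | ∃ y, Function.update v i y ∈ S} := by
  have hφ := hS.indicator_mem (R := ℤ)
  convert (finite_range_and_isConstructible_preimage
    (fiberIntegral_mem (T := -1) hf hφ i)).2 {0}ᶜ using 1
  ext v
  set P : Set M := {y | Function.update v i y ∈ S} with hP
  have hval : fiberIntegral (-1) i (S.indicator (1 : (α → M) → ℤ)) v =
    integral (-1) (P.indicator 1) := rfl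
  rw [mem_preimage, hval, mem_compl_singleton_iff]
  change P.Nonempty ↔ _
  obtain ⟨r, hr⟩ : P.indicator (1 : M → ℤ) ∈ almostConst ℤ M := section_mem_almostConst hf hφ i v
  have hfin : P.Finite ∨ Pᶜ.Finite := by
    have := Filter.eventually_cofinite.1 hr
    by_cases hr1 : r = 1
    · refine .inr (this.subset fun x hx => ?_)
      simp only [mem_ofPred_eq, indicator_of_notMem hx, hr1]
      exact zero_ne_one
    · refine .inl (this.subset fun x hx => ?_)
      simp only [mem_ofPred_eq, indicator_of_mem hx]
      exact Ne.symm hr1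
  rcases hfin with h | h
  · rw [integral_indicator_finite h, Int.natCast_ne_zero, ← Nat.pos_iff_ne_zero, ncard_pos h]
  · have hne : P.Nonempty := by
      rw [nonempty_iff_ne_empty]
      intro h0
      rw [h0, compl_empty] at h
      exact infinite_univ h
    rw [← compl_compl P, integral_indicator_compl h, compl_compl]
    refine iff_of_true hne ?_
    omega

theorem fiberIntegral_comm (hf : IsAcyclicShift f c) (hN : (N : R) = 0) {i j : α}
    {φ : (α → M) → R} (hφ : φ ∈ constructibleFun R α f) :
    fiberIntegral T i (fiberIntegral T j φ) = fiberIntegral T j (fiberIntegral T i φ) := by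
  rcases eq_or_ne i j with rfl | hij
  · rfl
  ext v
  have key : (fun x y => φ (Function.update (Function.update v i x) j y)) ∈ fubini M T := by
    induction hφ using Submodule.span_induction with
    | mem φ h =>
      obtain ⟨B, hB, rfl⟩ := h
      exact (hB.isPlanar_section hf i j v).mem_fubini hf hN T
    | zero => exact zero_mem (fubini M T)
    | add φ ψ _ _ h1 h2 => exact add_mem h1 h2
    | smul a φ _ h => exact Submodule.smul_mem _ a h
  refine key.2.2.2.2.trans ?_
  simp only [fiberIntegral, Function.update_comm hij]

end ConstructibleFun
/-! ### The Euler characteristic -/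

section MultiIntegral

variable {R M α γ : Type*} [CommRing R] [Infinite M] {N : ℕ} {f : M → M} {c : Fin N → M}

/-- Integration along the coordinate `i`, as an endomorphism of the module of constructible
functions. -/
def fiberIntegralEnd [DecidableEq α] (hf : IsAcyclicShift f c) (T : R) (i : α) :
    Module.End R (constructibleFun R α f) where
  toFun φ := ⟨fiberIntegral T i φ, fiberIntegral_mem hf φ.2 i⟩
  map_add' φ ψ := Subtype.ext (fiberIntegral_add hf φ.2 ψ.2 i)
  map_smul' a φ := Subtype.ext (fiberIntegral_smul hf a φ.2 i)

theorem commute_fiberIntegralEnd [DecidableEq α] (hf : IsAcyclicShift f c) (hN : (N : R) = 0)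
    (T : R) (i j : α) : Commute (fiberIntegralEnd hf T i) (fiberIntegralEnd hf T j) :=
  LinearMap.ext fun φ => Subtype.ext (fiberIntegral_comm hf hN φ.2)

theorem pairwise_commute_fiberIntegralEnd [DecidableEq α] (hf : IsAcyclicShift f c)
    (hN : (N : R) = 0) (T : R) (s : Finset α) :
    (s : Set α).Pairwise (Function.onFun Commute (fiberIntegralEnd hf T)) :=
  fun i _ j _ _ => commute_fiberIntegralEnd hf hN T i j

/-- Integration along the coordinates in the finite set `s`, in any order. -/
def multiIntegral [DecidableEq α] (hf : IsAcyclicShift f c) (hN : (N : R) = 0) (T : R)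
    (s : Finset α) : Module.End R (constructibleFun R α f) :=
  s.noncommProd (fiberIntegralEnd hf T) (pairwise_commute_fiberIntegralEnd hf hN T s)

variable [DecidableEq α] [DecidableEq γ] (hf : IsAcyclicShift f c) (hN : (N : R) = 0) (T : R)

@[simp] theorem multiIntegral_empty : multiIntegral hf hN T (∅ : Finset α) = 1 :=
  Finset.noncommProd_empty _ _

theorem multiIntegral_insert {s : Finset α} {i : α} (hi : i ∉ s) (φ : constructibleFun R α f) :
    (multiIntegral hf hN T (insert i s) φ : (α → M) → R) =
      fiberIntegral T i (multiIntegral hf hN T s φ) := by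
  rw [multiIntegral, Finset.noncommProd_insert_of_notMem _ _ _ _ hi]
  rfl

theorem multiIntegral_union {s t : Finset α} (hst : Disjoint s t) (φ : constructibleFun R α f) :
    multiIntegral hf hN T (s ∪ t) φ = multiIntegral hf hN T s (multiIntegral hf hN T t φ) := by
  rw [multiIntegral, Finset.noncommProd_union_of_disjoint hst]
  rfl

/-- Functions that do not depend on the variables of integration can be pulled out. -/
theorem multiIntegral_map (k : α ↪ γ) (s : Finset α) {g : (γ → M) → R}
    (hg : ∀ i w y, g (Function.update w (k i) y) = g w) (φ : constructibleFun R α f)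
    (Φ : constructibleFun R γ f) (h : ∀ w, Φ.1 w = g w * φ.1 (w ∘ k)) (w : γ → M) :
    (multiIntegral hf hN T (s.map k) Φ).1 w = g w * (multiIntegral hf hN T s φ).1 (w ∘ k) := by
  induction s using Finset.induction_on generalizing w with
  | empty => exact h w
  | insert i s hi ih =>
    rw [Finset.map_insert, multiIntegral_insert hf hN T (by simpa using hi),
      multiIntegral_insert hf hN T hi]
    have e : (fun y => (multiIntegral hf hN T (s.map k) Φ).1 (Function.update w (k i) y)) =
        g w • fun y => (multiIntegral hf hN T s φ).1 (Function.update (w ∘ k) i y) := by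
      ext y
      rw [ih, hg, Function.update_comp_eq_of_injective _ k.injective]
      rfl
    change integral T (fun y => (multiIntegral hf hN T (s.map k) Φ).1 _) = _
    rw [e, integral_smul _ (section_mem_almostConst hf (Subtype.prop _) i _)]
    rfl

/-- If a point of `A` is determined by its coordinates outside `s`, integration along the
coordinates in `s` yields the indicator function of the corresponding projection of `A`. -/
theorem multiIntegral_indicator {A : Set (α → M)} (hA : IsConstructible f A) (s : Finset α)
    (h : ∀ v ∈ A, ∀ w ∈ A, (∀ i ∉ s, v i = w i) → v = w) :
    (multiIntegral hf hN T s ⟨A.indicator 1, hA.indicator_mem⟩).1 =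
      {v | ∃ w ∈ A, ∀ i ∉ s, w i = v i}.indicator 1 := by
  induction s using Finset.induction_on with
  | empty =>
    have : {v | ∃ w ∈ A, ∀ i ∉ (∅ : Finset α), w i = v i} = A := by
      ext v
      simp [← funext_iff]
    rw [this]
    rfl
  | insert j s hj ih =>
    have hupd : ∀ (v : α → M) y, Function.update v j y ∈ {v | ∃ w ∈ A, ∀ i ∉ s, w i = v i} ↔
        ∃ w ∈ A, w j = y ∧ ∀ i ∉ insert j s, w i = v i := fun v y => by
      refine exists_congr fun w => and_congr_right fun _ => ⟨fun hw => ⟨?_, fun i hi => ?_⟩, ?_⟩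
      · simpa using hw j hj
      · rw [Finset.mem_insert, not_or] at hi
        simpa [hi.1] using hw i hi.2
      · rintro ⟨rfl, hw⟩ i hi
        rcases eq_or_ne i j with rfl | hij
        · simp
        · simpa [hij] using hw i (by simp [hi, hij])
    rw [multiIntegral_insert hf hN T hj, ih fun v hv w hw hvw => h v hv w hw fun i hi =>
      hvw i fun his => hi (Finset.mem_insert_of_mem his), fiberIntegral_indicator_of_subsingleton]
    · congr 1
      ext v
      simp only [mem_ofPred_eq]
      refine ⟨fun ⟨y, hy⟩ => ?_, fun ⟨w, hw, h'⟩ => ⟨w j, (hupd v _).2 ⟨w, hw, rfl, h'⟩⟩⟩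
      obtain ⟨w, hw, -, h'⟩ := (hupd v y).1 hy
      exact ⟨w, hw, h'⟩
    · intro v y hy y' hy'
      obtain ⟨w, hw, rfl, h1⟩ := (hupd v y).1 hy
      obtain ⟨w', hw', rfl, h2⟩ := (hupd v y').1 hy'
      rw [h w hw w' hw' fun i hi => (h1 i hi).trans (h2 i hi).symm]

end MultiIntegral

section EulerChar

variable {R M α β : Type*} [CommRing R] [Infinite M] {N : ℕ} {f : M → M} {c : Fin N → M}
  [Fintype α] [DecidableEq α] [Fintype β] [DecidableEq β]
  (hf : IsAcyclicShift f c) (hN : (N : R) = 0) (T : R)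

/-- The Euler characteristic of a constructible set: the integral of its indicator function along
all coordinates. The iterated integral is a function on `M ^ α`, which is evaluated at some point
of the diagonal. -/
def eulerChar {S : Set (α → M)} (hS : IsConstructible f S) : R :=
  (multiIntegral hf hN T Finset.univ ⟨S.indicator 1, hS.indicator_mem⟩).1
    fun _ => Classical.arbitrary M

omit [DecidableEq α] [DecidableEq β] in
theorem disjoint_map_inl_inr : Disjoint
    ((Finset.univ : Finset α).map (Function.Embedding.inl (β := β)))
    (Finset.univ.map Function.Embedding.inr) := by
  simp [Finset.disjoint_left]

theorem univ_sum_eq : (Finset.univ : Finset (α ⊕ β)) =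
    Finset.univ.map Function.Embedding.inl ∪ Finset.univ.map Function.Embedding.inr := by
  ext (i | i) <;> simp

/-- If `A ⊆ M ^ (α ⊕ β)` projects bijectively onto `S ⊆ M ^ α`, the two sets have the same Euler
characteristic. -/
theorem eulerChar_eq_of_existsUnique {A : Set (α ⊕ β → M)} (hA : IsConstructible f A)
    {S : Set (α → M)} (hS : IsConstructible f S) (h1 : ∀ x y, Sum.elim x y ∈ A → x ∈ S)
    (h2 : ∀ x ∈ S, ∃! y, Sum.elim x y ∈ A) : eulerChar hf hN T hA = eulerChar hf hN T hS := by
  rw [eulerChar, univ_sum_eq, multiIntegral_union hf hN T disjoint_map_inl_inr,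
    multiIntegral_map hf hN T Function.Embedding.inl Finset.univ (g := 1) (fun _ _ _ => rfl)
      ⟨S.indicator 1, hS.indicator_mem⟩]
  · rw [Pi.one_apply, one_mul]
    rfl
  · intro w
    rw [multiIntegral_indicator hf hN T hA]
    · rw [Pi.one_apply, one_mul]
      have : (∃ w' ∈ A, ∀ i ∉ Finset.univ.map Function.Embedding.inr, w' i = w i) ↔
          w ∘ Sum.inl ∈ S := by
        constructor
        · rintro ⟨w', hw', h⟩
          rw [← Sum.elim_comp_inl_inr w'] at hw'
          have : w' ∘ Sum.inl = w ∘ Sum.inl := funext fun i => h (Sum.inl i) (by simp)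
          exact this ▸ h1 _ _ hw'
        · intro hw
          obtain ⟨y, hy, -⟩ := h2 _ hw
          refine ⟨_, hy, ?_⟩
          rintro (i | i) hi
          · rfl
          · simp at hi
      change _ = S.indicator 1 (w ∘ Sum.inl)
      by_cases hw : w ∘ Sum.inl ∈ S
      · rw [indicator_of_mem hw]
        exact indicator_of_mem (s := {v | ∃ w ∈ A, _}) (this.2 hw) _
      · rw [indicator_of_notMem hw]
        exact indicator_of_notMem (s := {v | ∃ w ∈ A, _}) (mt this.1 hw) _
    · intro v hv w hw h
      have hvw : v ∘ Sum.inl = w ∘ Sum.inl := funext fun i => h (Sum.inl i) (by simp)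
      rw [← Sum.elim_comp_inl_inr v] at hv ⊢
      rw [← Sum.elim_comp_inl_inr w, ← hvw] at hw ⊢
      rw [(h2 _ (h1 _ _ hv)).unique hv hw]

theorem eulerChar_prod {S : Set (α → M)} (hS : IsConstructible f S) {S' : Set (β → M)}
    (hS' : IsConstructible f S')
    (hP : IsConstructible f {w : α ⊕ β → M | w ∘ Sum.inl ∈ S ∧ w ∘ Sum.inr ∈ S'}) :
    eulerChar hf hN T hP = eulerChar hf hN T hS * eulerChar hf hN T hS' := by
  rw [eulerChar, univ_sum_eq, multiIntegral_union hf hN T disjoint_map_inl_inr,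
    multiIntegral_map hf hN T Function.Embedding.inl Finset.univ
      (g := fun w => (multiIntegral hf hN T Finset.univ
        ⟨S'.indicator 1, hS'.indicator_mem⟩).1 (w ∘ Sum.inr)) ?_ ⟨S.indicator 1, hS.indicator_mem⟩,
    mul_comm]
  · rfl
  · intro w
    rw [multiIntegral_map hf hN T Function.Embedding.inr Finset.univ
      (g := fun w => S.indicator 1 (w ∘ Sum.inl)) ?_ ⟨S'.indicator 1, hS'.indicator_mem⟩ _ ?_,
      mul_comm]
    · rfl
    · intro i w y
      congr 1
    · intro w
      change _ = _ * S'.indicator 1 (w ∘ Sum.inr)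
      by_cases h : w ∘ Sum.inl ∈ S <;> by_cases h' : w ∘ Sum.inr ∈ S' <;> simp [h, h']
  · intro i w y
    congr 1

theorem eulerChar_union {S S' : Set (α → M)} (hS : IsConstructible f S)
    (hS' : IsConstructible f S') (h : Disjoint S S') :
    eulerChar hf hN T (hS.union hS') = eulerChar hf hN T hS + eulerChar hf hN T hS' := by
  have : (⟨(S ∪ S').indicator 1, (hS.union hS').indicator_mem⟩ : constructibleFun R α f) =
      ⟨S.indicator 1, hS.indicator_mem⟩ + ⟨S'.indicator 1, hS'.indicator_mem⟩ :=
    Subtype.ext (indicator_union_of_disjoint h _)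
  rw [eulerChar, this, map_add]
  rfl

theorem eulerChar_of_isEmpty [IsEmpty α] :
    eulerChar hf hN T (IsConstructible.univ : IsConstructible f (univ : Set (α → M))) = 1 := by
  rw [eulerChar, Finset.univ_eq_empty, multiIntegral_empty]
  simp

theorem eulerChar_empty :
    eulerChar hf hN T (IsConstructible.empty : IsConstructible f (∅ : Set (α → M))) = 0 := by
  simpa using eulerChar_union hf hN T (.empty : IsConstructible f (∅ : Set (α → M))) .empty
    (disjoint_empty ∅)

theorem eulerChar_univ_of_unique [Unique α] :
    eulerChar hf hN T (IsConstructible.univ : IsConstructible f (univ : Set (α → M))) = T := by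
  rw [eulerChar, Finset.univ_unique, ← insert_empty_eq,
    multiIntegral_insert hf hN T (Finset.notMem_empty _), multiIntegral_empty]
  change integral T (fun y => (univ : Set (α → M)).indicator 1 _) = T
  simp only [indicator_univ, Pi.one_apply]
  rw [integral_const, one_mul]

theorem eulerChar_reindex {S : Set (α → M)}
    (hS : IsConstructible f S) (e : α ≃ β) (hS' : IsConstructible f {w : β → M | w ∘ e ∈ S}) :
    eulerChar hf hN T hS' = eulerChar hf hN T hS := by
  rw [eulerChar, ← Finset.map_univ_equiv e, multiIntegral_map hf hN T e.toEmbedding Finset.univ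
    (g := 1) (fun _ _ _ => rfl) ⟨S.indicator 1, hS.indicator_mem⟩, Pi.one_apply, one_mul]
  · rfl
  · intro w
    rw [Pi.one_apply, one_mul]
    rfl

end EulerChar
end ShiftSets

namespace NoCycles

open ShiftSets DefinableSets

/-! ### Definable sets are constructible -/

variable {M : Type*} [lang.Structure M] {N : ℕ} {c : Fin N → M}

theorem isAcyclicShift_of_model (hM : M ⊨ theory N) :
    ∃ c : Fin N → M, IsAcyclicShift (interp M) c := by
  obtain ⟨h1, ⟨c, h2, h3⟩, h4⟩ := model_iff.1 hM
  exact ⟨c, h1, h2, h3, h4⟩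

theorem exists_realize_eq_iterate {γ : Type*} (t : lang.Term γ) :
    ∃ k x, ∀ v : γ → M, t.realize v = (interp M)^[k] (v x) := by
  induction t with
  | var x => exact ⟨0, x, fun v => rfl⟩
  | func s ts ih =>
    cases s
    obtain ⟨k, x, h⟩ := ih 0
    refine ⟨k + 1, x, fun v => ?_⟩
    rw [Function.iterate_succ_apply', ← h]
    change Structure.funMap _ _ = Structure.funMap (L := lang) (n := 1) Func.f _
    congr 1
    ext i
    rw [Subsingleton.elim i 0]
    rfl

/-- Quantifier elimination: a formula defines a constructible set, whichever variables or
constants are substituted for its free variables. -/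
theorem isConstructible_realize (hf : IsAcyclicShift (interp M) c) {A β : Type*} {n : ℕ}
    (φ : lang.BoundedFormula A n) (g : A → β ⊕ M) : IsConstructible (interp M)
      {w : β ⊕ Fin n → M | φ.Realize (fun a => val (g a) (w ∘ Sum.inl)) (w ∘ Sum.inr)} := by
  classical
  induction φ with
  | falsum => exact .empty
  | @equal n t s =>
    obtain ⟨k, x, hx⟩ := exists_realize_eq_iterate (M := M) t
    obtain ⟨l, y, hy⟩ := exists_realize_eq_iterate (M := M) s
    have hval : ∀ (x : A ⊕ Fin n) (w : β ⊕ Fin n → M),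
        Sum.elim (fun a => val (g a) (w ∘ Sum.inl)) (w ∘ Sum.inr) x =
          val (Sum.elim (fun a => Sum.map Sum.inl id (g a))
            (fun i => Sum.inl (Sum.inr i)) x) w := by
      rintro (a | i) w
      · change val (g a) (w ∘ Sum.inl) = val (Sum.map Sum.inl id (g a)) w
        rcases g a with b | b <;> rfl
      · rfl
    convert IsConstructible.atom (f := interp M) k _ l _ using 1
    ext w
    simp only [mem_ofPred_eq, BoundedFormula.Realize, hx, hy, hval]
    exact Iff.rfl
  | rel R => exact R.elim
  | imp φ ψ h1 h2 =>
    convert h1.compl.union h2 using 1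
    ext w
    simp only [mem_ofPred_eq, BoundedFormula.realize_imp, mem_union, mem_compl_iff]
    tauto
  | @all n φ h =>
    rcases isEmpty_or_nonempty M with hM | ⟨⟨a⟩⟩
    · convert IsConstructible.univ (f := interp M) using 1
      exact eq_univ_of_forall fun w y => (hM.false y).elim
    have : Nonempty M := ⟨a⟩
    have := infinite hf
    -- The quantified variable becomes the last coordinate, which is then set to a constant.
    have key := (h.compl.exists_update hf (Sum.inr (Fin.last n))).compl.subst
      (β := β ⊕ Fin n) (Sum.elim (fun b => Sum.inl (Sum.inl b))
        (Fin.snoc (α := fun _ => (β ⊕ Fin n) ⊕ M) (fun i => Sum.inl (Sum.inr i)) (Sum.inr a)))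
    convert key using 1
    ext w
    simp only [mem_ofPred_eq, BoundedFormula.realize_all, mem_compl_iff, not_exists, not_not]
    refine forall_congr' fun y => ?_
    refine iff_of_eq (congr_arg₂ _ (funext fun a => ?_) (funext fun i => ?_))
    · rcases g a with b | b <;> simp
    · refine Fin.lastCases ?_ (fun i => ?_) i
      · simp
      · simp

theorem isConstructible_of_isDef (hf : IsAcyclicShift (interp M) c) {α : Type} {S : Set (α → M)}
    (hS : IsDef lang S) : IsConstructible (interp M) S := by
  obtain ⟨φ, rfl⟩ := definable_iff_exists_formula_sum.1 hS
  convert (isConstructible_realize hf φ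
    (Sum.elim (fun a => Sum.inr a.1) Sum.inl : _ → α ⊕ M)).subst
    (Sum.elim Sum.inl Fin.elim0 : α ⊕ Fin 0 → α ⊕ M) using 1
  ext v
  simp only [mem_ofPred_eq, Formula.Realize]
  refine iff_of_eq (congr_arg₂ _ (funext fun a => ?_) (Subsingleton.elim _ _))
  rcases a with a | a <;> rfl

theorem isDef_atom {α : Type} (n : ℕ) (p : α ⊕ M) (m : ℕ) (q : α ⊕ M) :
    IsDef lang (atom (interp M) n p m q) := by
  have key : ∀ (n : ℕ) (p : α ⊕ M),
      (univ : Set M).DefinableFun lang fun v : α → M => (interp M)^[n] (val p v) := by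
    intro n p
    rcases p with i | a
    · have := Term.definableFun_realize (L := lang) (M := M) (app^[n] (Term.var i))
      simp only [Term.realize_var, realize_iterate] at this
      exact DefinableFun.of_empty this
    · exact definableFun_const lang α (mem_univ ((interp M)^[n] a))
  exact DefinableFun.ofPred_eq (key n p) (key m q)

theorem isDef_of_isConstructible {α : Type} {S : Set (α → M)}
    (hS : IsConstructible (interp M) S) : IsDef lang S := by
  induction hS with
  | empty => exact definable_empty
  | univ => exact definable_univ
  | ite n p m q _ _ h1 h2 =>
    exact (h1.inter (isDef_atom n p m q)).union (h2.sdiff (isDef_atom n p m q))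

/-! ### The homomorphism from the Grothendieck ring -/

variable {R M : Type*} [CommRing R] [lang.Structure M] [Infinite M] {N : ℕ} {c : Fin N → M}

theorem eulerChar_eq_of_defBij {α β : Type} [Fintype α] [DecidableEq α] [Fintype β]
    [DecidableEq β] (hf : IsAcyclicShift (interp M) c) (hN : (N : R) = 0) (T : R)
    {S : Set (α → M)} {S' : Set (β → M)} (hS : IsConstructible (interp M) S)
    (hS' : IsConstructible (interp M) S') (h : DefBij lang S S') :
    eulerChar hf hN T hS = eulerChar hf hN T hS' := by
  obtain ⟨A, hA, h, h1, h2⟩ := defBij_iff.1 h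
  have hA₁ := isConstructible_of_isDef hf hA
  have hA₂ : IsConstructible (interp M) {w : β ⊕ α → M | w ∘ Equiv.sumComm α β ∈ A} :=
    isConstructible_of_isDef hf (hA.preimage_comp (Equiv.sumComm α β))
  have hswap : ∀ (y : β → M) (x : α → M),
      Sum.elim y x ∘ Equiv.sumComm α β = Sum.elim x y := fun y x => by
    ext (i | i) <;> rfl
  rw [← eulerChar_eq_of_existsUnique hf hN T hA₁ hS (fun x y hxy => (h x y hxy).1) h1,
    ← eulerChar_reindex hf hN T hA₁ (Equiv.sumComm α β) hA₂]
  refine eulerChar_eq_of_existsUnique hf hN T hA₂ hS' (fun y x hxy => ?_) fun y hy => ?_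
  · rw [mem_ofPred_eq, hswap] at hxy
    exact (h x y hxy).2
  · simpa only [mem_ofPred_eq, hswap] using h2 y hy

/-- The Euler characteristic of a class of definable sets. -/
def eulerClass (hf : IsAcyclicShift (interp M) c) (hN : (N : R) = 0) (T : R) :
    GrothendieckSemiring lang M → R :=
  Quotient.lift (fun A => eulerChar hf hN T (isConstructible_of_isDef hf A.isDef))
    fun _ _ h => eulerChar_eq_of_defBij hf hN T _ _ h

theorem eulerClass_cls {α : Type} [Fintype α] [DecidableEq α] (hf : IsAcyclicShift (interp M) c)
    (hN : (N : R) = 0) (T : R) {S : Set (α → M)} (hS : IsDef lang S) :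
    eulerClass hf hN T (.cls S hS) = eulerChar hf hN T (isConstructible_of_isDef hf hS) :=
  eulerChar_eq_of_defBij hf hN T
    (isConstructible_of_isDef hf (hS.preimage_comp (Finite.equivFin α))) _
    (DefBij.reindex hS _).symm

/-- The Euler characteristic, as a homomorphism on the Grothendieck semiring. -/
def eulerHom (hf : IsAcyclicShift (interp M) c) (hN : (N : R) = 0) (T : R) :
    GrothendieckSemiring lang M →+* R where
  toFun := eulerClass hf hN T
  map_zero' := (eulerClass_cls hf hN T (definable_empty (α := Fin 0))).trans
    (eulerChar_empty hf hN T)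
  map_one' := (eulerClass_cls hf hN T (definable_univ (α := Fin 0))).trans
    (eulerChar_of_isEmpty hf hN T)
  map_add' a b := by
    induction a, b using GrothendieckSemiring.ind_disjoint with
    | h α S S' hS hS' hd =>
      classical
      have := Fintype.ofFinite α
      rw [← GrothendieckSemiring.cls_union hS hS' hd, eulerClass_cls, eulerClass_cls,
        eulerClass_cls]
      exact eulerChar_union hf hN T _ _ hd
  map_mul' a b := by
    induction a using GrothendieckSemiring.ind with
    | _ n S hS =>
      induction b using GrothendieckSemiring.ind with
      | _ m S' hS' =>
        rw [GrothendieckSemiring.cls_mul_cls, eulerClass_cls, eulerClass_cls, eulerClass_cls]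
        exact eulerChar_prod hf hN T _ _ _

end NoCycles

namespace RingCompletion

/-- The universal property of the ring completion. -/
def lift {R S : Type*} [CommSemiring R] [CommRing S] (f : R →+* S) : RingCompletion R →+* S where
  __ := liftAdd f.toAddMonoidHom
  map_one' := (liftAdd_ofAdd f.toAddMonoidHom 1).trans f.map_one
  map_mul' x y := by
    change liftAdd f.toAddMonoidHom (x * y) =
      liftAdd f.toAddMonoidHom x * liftAdd f.toAddMonoidHom y
    induction x using ind with
    | h a =>
      induction y using ind with
      | h b => simp [ofAdd_mul_ofAdd, liftAdd_ofAdd]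
      | hs y z hy hz => rw [mul_sub, map_sub, hy, hz, map_sub, mul_sub]
    | hs x z hx hz => rw [sub_mul, map_sub, hx, hz, map_sub, sub_mul]

theorem lift_of {R S : Type*} [CommSemiring R] [CommRing S] (f : R →+* S) (a : R) :
    lift f (of a) = f a := liftAdd_ofAdd f.toAddMonoidHom a

end RingCompletion

namespace NoCycles

open ShiftSets DefinableSets GrothendieckSemiring

/-! ### Generation by the class of the structure -/

section Generation

variable {M : Type*} [lang.Structure M] [Nontrivial M] {N : ℕ} {c : Fin N → M}

theorem cls_empty {α : Type} [Finite α] (h : IsDef lang (∅ : Set (α → M))) : cls ∅ h = 0 :=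
  (cls_eq_cls (hT := definable_empty (α := Fin 0))).2 <|
    .of_maps definable_empty (fun _ => Fin.elim0) (fun _ _ => Classical.arbitrary M)
      (fun i => i.elim0) (fun _ hx => hx.elim) fun _ hy => hy.elim

/-- The class of a set of `k` elements of `M` is `k`. -/
theorem cls_finset (s : Finset M) (hs : IsDef lang {x : Fin 1 → M | x 0 ∈ s}) :
    cls {x : Fin 1 → M | x 0 ∈ s} hs = s.card := by
  classical
  induction s using Finset.induction_on with
  | empty =>
    rw [Finset.card_empty, Nat.cast_zero, ← cls_empty (α := Fin 1) definable_empty]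
    exact cls_congr (by simp) _ _
  | insert a s ha ih =>
    have h1 : IsDef lang {x : Fin 1 → M | x 0 = a} :=
      DefinableFun.ofPred_eq_const (DefinableFun.proj lang) (mem_univ a)
    have h2 : IsDef lang {x : Fin 1 → M | x 0 ∈ s} := by
      convert hs.sdiff h1 using 1
      ext x
      simp only [Finset.mem_insert, Set.mem_sdiff, mem_ofPred_eq]
      constructor
      · exact fun h => ⟨.inr h, fun h' => ha (h' ▸ h)⟩
      · exact fun h => h.1.resolve_left h.2
    have hd : Disjoint {x : Fin 1 → M | x 0 = a} {x : Fin 1 → M | x 0 ∈ s} :=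
      Set.disjoint_left.2 fun x hx hx' => ha (hx ▸ hx')
    have h3 : cls {x : Fin 1 → M | x 0 = a} h1 = 1 :=
      (cls_eq_cls (hT := definable_univ (α := Fin 0))).2 <|
        .of_maps h1 (fun _ => Fin.elim0) (fun _ _ => a) (fun i => i.elim0)
          (fun x hx => ⟨trivial, funext fun i => by rw [Subsingleton.elim i 0, ← hx]⟩)
          fun y _ => ⟨rfl, Subsingleton.elim _ _⟩
    rw [Finset.card_insert_of_notMem ha, Nat.cast_succ, ← ih h2, ← h3, add_comm,
      ← cls_union h1 h2 hd]
    exact cls_congr (by ext; simp) _ _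

/-- `f` is a definable bijection from `M` to `f(M)`, whence `[M] = [M] + N`. -/
theorem natCast_eq_zero (hf : IsAcyclicShift (interp M) c) : (N : K₀ lang M) = 0 := by
  classical
  have hmap : (univ : Set M).DefinableMap lang fun (x : Fin 1 → M) (_ : Fin 1) => interp M (x 0) :=
    fun _ => by
      have := Term.definableFun_realize (L := lang) (M := M) (app (Term.var (0 : Fin 1)))
      simp only [Term.realize_var, realize_app] at this
      exact DefinableFun.of_empty this
  have hset : {x : Fin 1 → M | x 0 ∈ range (interp M)} =
      {x : Fin 1 → M | x 0 ∈ Finset.univ.image c}ᶜ := by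
    ext x
    rw [mem_compl_iff, mem_ofPred_eq, mem_ofPred_eq, ← not_iff_not, ← mem_compl_iff, hf.compl_range]
    simp
  have h2 : IsDef lang {x : Fin 1 → M | x 0 ∈ Finset.univ.image c} := by
    convert definable_iUnion_of_finite (L := lang) (A := (univ : Set M)) (α := Fin 1) fun j =>
      DefinableFun.ofPred_eq_const (DefinableFun.proj lang (i := 0)) (mem_univ (c j)) using 1
    ext x
    simp [eq_comm]
  have h1 : IsDef lang {x : Fin 1 → M | x 0 ∈ range (interp M)} := hset ▸ h2.compl
  have h3 : cls {x : Fin 1 → M | x 0 ∈ range (interp M)} h1 =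
      cls (univ : Set (Fin 1 → M)) definable_univ :=
    (cls_eq_cls.2 (.of_maps definable_univ _ (fun y _ => Function.invFun (interp M) (y 0)) hmap
      (fun x _ => ⟨mem_range_self (x 0), funext fun i => by
        rw [Function.leftInverse_invFun hf.injective, Subsingleton.elim i 0]⟩)
      fun y hy => ⟨trivial, funext fun i => by
        rw [Subsingleton.elim i 0]; exact Function.invFun_eq hy⟩)).symm
  have h4 := cls_union h1 h2 (hset ▸ disjoint_compl_left)
  rw [cls_congr (by rw [hset, compl_union_self]) _ definable_univ, h3, cls_finset,
    Finset.card_image_of_injective _ hf.injective_points, Finset.card_univ, Fintype.card_fin] at h4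
  have h5 := congrArg (RingCompletion.of (R := GrothendieckSemiring lang M)) h4
  rw [map_add, map_natCast] at h5
  exact left_eq_add.1 h5

/-- The subring of the Grothendieck ring generated by the class of the structure. -/
def selfSubring (M : Type*) [lang.Structure M] [Nontrivial M] : Subring (K₀ lang M) :=
  (Polynomial.eval₂RingHom (Int.castRingHom _) (K₀.self lang M)).range

/-- A system of equations in `n + 1` unknowns is either a cylinder over a definable subset of
`M ^ n` or in definable bijection with its projection to `M ^ n`. -/
theorem exists_cls_system (hf : IsAcyclicShift (interp M) c) {n : ℕ} {B : Set (Fin (n + 1) → M)}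
    (hB : IsSystem (interp M) B) (hD : IsDef lang B) :
    ∃ (S : Set (Fin n → M)) (hS : IsDef lang S), cls B hD = cls S hS ∨
      cls B hD = cls (univ : Set (Fin 1 → M)) definable_univ * cls S hS := by
  rcases hB.isFree_or_subsingleton hf 0 with h | h
  · have hmem : ∀ y y' u, (Fin.cons y u : Fin (n + 1) → M) ∈ B ↔ Fin.cons y' u ∈ B :=
      fun y y' u => by rw [← h _ y', Fin.update_cons_zero]
    have a := Classical.arbitrary M
    have hS : IsDef lang {u : Fin n → M | (Fin.cons a u : Fin (n + 1) → M) ∈ B} := by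
      refine Definable.preimage_map (F := fun u : Fin n → M => (Fin.cons a u : Fin (n + 1) → M))
        (fun i => ?_) hD
      refine Fin.cases ?_ (fun i => ?_) i
      · simpa using definableFun_const lang _ (mem_univ a)
      · simpa using DefinableFun.proj lang
    refine ⟨_, hS, .inr ?_⟩
    rw [cls_mul_cls]
    refine cls_eq_cls.2 (.of_maps hD (fun w => Sum.elim (fun _ => w 0) (Fin.tail w))
      (fun z => Fin.cons (z (Sum.inl 0)) (z ∘ Sum.inr)) ?_ (fun w hw => ⟨⟨trivial, ?_⟩, ?_⟩)
      fun z hz => ⟨?_, ?_⟩)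
    · rintro (i | i)
      · exact DefinableFun.proj lang
      · exact DefinableFun.proj lang
    · rw [← Fin.cons_self_tail w] at hw
      exact (hmem _ _ _).1 hw
    · exact Fin.cons_self_tail w
    · exact (hmem _ _ _).1 hz.2
    · ext (i | i)
      · rw [Subsingleton.elim i 0]; rfl
      · rfl
  · have hinj : InjOn (fun w : Fin (n + 1) → M => w ∘ Fin.succ) B := fun w hw w' hw' hww => by
      have e : ∀ w : Fin (n + 1) → M, w = Fin.cons (w 0) (w ∘ Fin.succ) := fun w =>
        (Fin.cons_self_tail w).symm
      have h0 : w 0 = w' 0 := by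
        refine h w ?_ ?_
        · simpa using hw
        · rw [mem_ofPred_eq, e w, Fin.update_cons_zero]
          rw [e w', ← show w ∘ Fin.succ = w' ∘ Fin.succ from hww] at hw'
          exact hw'
      rw [e w, e w', h0]
      exact congrArg _ hww
    refine ⟨_, hD.image_comp Fin.succ, .inl (cls_eq_cls.2 (.of_maps hD _
      (Function.invFunOn (fun w : Fin (n + 1) → M => w ∘ Fin.succ) B)
      (fun i => DefinableFun.proj lang)
      (fun w hw => ⟨mem_image_of_mem _ hw, hinj.leftInvOn_invFunOn hw⟩)
      fun u hu => ⟨Function.invFunOn_mem hu, Function.invFunOn_eq hu⟩))⟩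

theorem of_cls_mem_selfSubring (hf : IsAcyclicShift (interp M) c) {n : ℕ} (S : Set (Fin n → M))
    (hS : IsDef lang S) : RingCompletion.of (cls S hS) ∈ selfSubring M := by
  have hself : K₀.self lang M ∈ selfSubring M := ⟨Polynomial.X, by simp⟩
  induction n with
  | zero =>
    rcases S.eq_empty_or_nonempty with rfl | hne
    · rw [cls_empty hS, map_zero]
      exact zero_mem _
    · rw [cls_congr (T := univ) hne.eq_univ hS definable_univ]
      exact one_mem (selfSubring M)
  | succ n ih =>
    have hsys : ∀ (B : Set (Fin (n + 1) → M)) (_ : IsSystem (interp M) B) (hD : IsDef lang B),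
        RingCompletion.of (cls B hD) ∈ selfSubring M := by
      intro B hB hD
      obtain ⟨S, hS, h | h⟩ := exists_cls_system hf hB hD
      · rw [h]
        exact ih S hS
      · rw [h, map_mul]
        exact mul_mem hself (ih S hS)
    have key : ∀ S : Set (Fin (n + 1) → M), IsConstructible (interp M) S →
        ∀ B, IsSystem (interp M) B → ∀ hD : IsDef lang (B ∩ S),
          RingCompletion.of (cls (B ∩ S) hD) ∈ selfSubring M := by
      intro S hS
      induction hS with
      | empty =>
        intro B hB hD
        rw [cls_congr (inter_empty B) hD definable_empty, cls_empty, map_zero]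
        exact zero_mem _
      | univ =>
        intro B hB hD
        rw [cls_congr (inter_univ B) hD (inter_univ B ▸ hD)]
        exact hsys B hB _
      | @ite n p m q S T hS hT h1 h2 =>
        intro B hB hD
        have hA := isDef_atom n p m q
        have hBD := isDef_of_isConstructible hB.isConstructible
        have hTD := isDef_of_isConstructible hT
        have hSD := isDef_of_isConstructible hS
        -- `[B ∩ ite A S T] = [A ∩ B ∩ S] + [B ∩ T] - [A ∩ B ∩ T]`
        have e := cls_union ((hA.inter hBD).inter hSD) ((hBD.inter hTD).sdiff hA)
          (Set.disjoint_left.2 fun v hv hv' => hv'.2 hv.1.1)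
        have e' := cls_union ((hA.inter hBD).inter hTD) ((hBD.inter hTD).sdiff hA)
          (Set.disjoint_left.2 fun v hv hv' => hv'.2 hv.1.1)
        rw [cls_congr (T := B ∩ (atom (interp M) n p m q).ite S T) (by
          ext v
          simp only [Set.ite, mem_union, mem_inter_iff, Set.mem_sdiff]
          tauto) _ hD] at e
        rw [cls_congr (T := B ∩ T) (by
          ext v
          simp only [mem_union, mem_inter_iff, Set.mem_sdiff]
          tauto) _ (hBD.inter hTD)] at e'
        have hS' := h1 _ (hB.inter n p m q) ((hA.inter hBD).inter hSD)
        have hT' := h2 _ (hB.inter n p m q) ((hA.inter hBD).inter hTD)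
        have hT'' := h2 B hB (hBD.inter hTD)
        rw [e', map_add] at hT''
        rw [e, map_add]
        exact add_mem hS' ((add_mem_cancel_left hT').1 hT'')
    have := key S (isConstructible_of_isDef hf hS) univ .univ (definable_univ.inter hS)
    rwa [cls_congr (univ_inter S) _ hS] at this

theorem mem_selfSubring (hf : IsAcyclicShift (interp M) c) (x : K₀ lang M) :
    x ∈ selfSubring M := by
  obtain ⟨a, b, rfl⟩ := RingCompletion.exists_eq_sub x
  have h : ∀ a, RingCompletion.of a ∈ selfSubring M := fun a => by
    induction a using GrothendieckSemiring.ind with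
    | _ n S hS => exact of_cls_mem_selfSubring hf S hS
  exact sub_mem (h a) (h b)

end Generation

end NoCycles

end

theorem theorem2 (N : ℕ) (hN : 0 < N) (M : Type*) [NoCycles.lang.Structure M]
    (hM : M ⊨ NoCycles.theory N) :
    haveI : Nontrivial M := NoCycles.nontrivial_of_model hN hM
    ∃ e : K₀ NoCycles.lang M ≃+* Polynomial (ZMod N),
      e (K₀.self NoCycles.lang M) = Polynomial.X := by
  have : Nontrivial M := NoCycles.nontrivial_of_model hN hM
  obtain ⟨c, hf⟩ := NoCycles.isAcyclicShift_of_model hM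
  have : Infinite M := ShiftSets.infinite hf
  have hN0 : (N : Polynomial (ZMod N)) = 0 := by
    rw [← map_natCast Polynomial.C, ZMod.natCast_self, map_zero]
  let χ : K₀ NoCycles.lang M →+* Polynomial (ZMod N) :=
    RingCompletion.lift (NoCycles.eulerHom hf hN0 Polynomial.X)
  have hχ : χ (K₀.self NoCycles.lang M) = Polynomial.X :=
    (RingCompletion.lift_of _ _).trans <|
      (NoCycles.eulerClass_cls hf hN0 _ Set.definable_univ).trans <|
      ShiftSets.eulerChar_univ_of_unique hf hN0 _
  have hcomp : χ.comp (Polynomial.eval₂RingHom (Int.castRingHom _) (K₀.self NoCycles.lang M)) =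
      Polynomial.mapRingHom (Int.castRingHom (ZMod N)) :=
    Polynomial.ringHom_ext' (RingHom.ext_int _ _) (by simpa using hχ)
  refine ⟨RingEquiv.ofBijective χ ⟨?_, fun p => ?_⟩, hχ⟩
  · rw [injective_iff_map_eq_zero]
    intro x hx
    obtain ⟨p, rfl⟩ := NoCycles.mem_selfSubring hf x
    have hp : p.map (Int.castRingHom (ZMod N)) = 0 := (RingHom.congr_fun hcomp p).symm.trans hx
    -- The coefficients of `p` are multiples of `N`, which is zero in the Grothendieck ring.
    obtain ⟨q, rfl⟩ : Polynomial.C (N : ℤ) ∣ p := by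
      rw [Polynomial.C_dvd_iff_dvd_coeff]
      intro i
      rw [← ZMod.intCast_zmod_eq_zero_iff_dvd]
      simpa using congrArg (fun r => Polynomial.coeff r i) hp
    rw [map_mul]
    simp [NoCycles.natCast_eq_zero hf]
  · obtain ⟨q, rfl⟩ := Polynomial.map_surjective _ (ZMod.ringHom_surjective
      (Int.castRingHom (ZMod N))) p
    exact ⟨_, RingHom.congr_fun hcomp q⟩
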